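/- Let $A$ be a $d\times n$ integer matrix of rank $d$ all of whose maximal minors lie in $\{-1,0,1\}$, and let $Z=A\cdot[0,1]^n\subseteq\mathbb{R}^d$ be the corresponding unimodular zonotope. For a finite set $S\subseteq\mathbb{C}^d$ let $\mathrm{Orb}(S)=\mathbb{C}[x_1,\dots,x_d]/\mathrm{gr}\,I(S)$, where $\mathrm{gr}\,I(S)$ is the ideal generated by the top-degree homogeneous components of the polynomials vanishing on $S$; it is graded by degree. Put $$i_Z(m;q)=\mathrm{Hilb}(\mathrm{Orb}(mZ\cap\mathbb{Z}^d);q),\qquad \widetilde{i_Z}(m;q)=\mathrm{Hilb}(\mathrm{Orb}(\mathrm{int}(mZ)\cap\mathbb{Z}^d);q),$$ $$E_Z(t,q)=\sum_{m\ge 0} i_Z(m;q)\,t^m,\qquad \widetilde{E_Z}(t,q)=\sum_{m\ge 1}\widetilde{i_Z}(m;q)\,t^m .$$ Then $E_Z(t,q)$ and $\widetilde{E_Z}(t,q)$ are (expansions of) rational functions in $\mathbb{Q}(t,q)$, and they can be written as $$E_Z(t,q)=\frac{N_Z(t,q)}{\prod_{i=0}^n(1-tq^i)},\qquad \widetilde{E_Z}(t,q)=\frac{t\,N'_Z(t,q)}{\prod_{i=0}^n(1-tq^i)},$$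 where $N_Z,N'_Z\in\mathbb{Z}[t,q]$ have $t$-degree at most $n$ (so the numerator of $\widetilde{E_Z}$ is divisible by $t$ and has $t$-degree at most $n+1$). Moreover, as an identity of rational functions in $\mathbb{Q}(t,q)$, $$q^d\,\widetilde{E_Z}(t,q)=(-1)^{d+1}E_Z(t^{-1},q^{-1}).$$ -/

import Mathlib

open scoped Pointwise

noncomputable section

/-! ## Orbit harmonics -/

/-- The lattice points of a subset `P` of `ℝᵈ`, viewed as a point locus in `ℂᵈ`. -/
def latticeLocus {d : ℕ} (P : Set (Fin d → ℝ)) : Set (Fin d → ℂ) :=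
  {x | ∃ z : Fin d → ℤ, (fun i => (z i : ℝ)) ∈ P ∧ x = fun i => (z i : ℂ)}

/-- The ideal generated by the top degree homogeneous components of the elements of `I`. -/
def grIdeal {d : ℕ} (I : Ideal (MvPolynomial (Fin d) ℂ)) : Ideal (MvPolynomial (Fin d) ℂ) :=
  Ideal.span {g | ∃ f ∈ I, g = MvPolynomial.homogeneousComponent f.totalDegree f}

/-- The orbit harmonics ring `ℂ[x₁, …, x_d] / gr I(S)` of a point locus `S`. -/
abbrev Orb {d : ℕ} (S : Set (Fin d → ℂ)) : Type :=
  MvPolynomial (Fin d) ℂ ⧸ grIdeal (MvPolynomial.vanishingIdeal ℂ S)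

/-- The degree `j` piece of `Orb S`: the image of the homogeneous polynomials of degree `j`. -/
def orbPiece {d : ℕ} (S : Set (Fin d → ℂ)) (j : ℕ) : Submodule ℂ (Orb S) :=
  (MvPolynomial.homogeneousSubmodule (Fin d) ℂ j).map
    (Ideal.Quotient.mkₐ ℂ (grIdeal (MvPolynomial.vanishingIdeal ℂ S))).toLinearMap

/-- The Hilbert series `∑ⱼ dim (Orb S)ⱼ qʲ`. -/
def orbHilb {d : ℕ} (S : Set (Fin d → ℂ)) : PowerSeries ℤ :=
  PowerSeries.mk fun j => (Module.finrank ℂ (orbPiece S j) : ℤ)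

/-! ## Graded Ehrhart series -/

/-- The graded lattice point count `i_P(m;q)`. -/
def gradedCount {d : ℕ} (P : Set (Fin d → ℝ)) (m : ℕ) : PowerSeries ℤ :=
  orbHilb (latticeLocus ((m : ℝ) • P))

/-- The graded interior lattice point count `ĩ_P(m;q)`. -/
def gradedInteriorCount {d : ℕ} (P : Set (Fin d → ℝ)) (m : ℕ) : PowerSeries ℤ :=
  orbHilb (latticeLocus (interior ((m : ℝ) • P)))

/-- The graded Ehrhart series `E_P(t,q) = ∑_{m ≥ 0} i_P(m;q) tᵐ`, a formal power series in the
variables `t` (index `0`) and `q` (index `1`). -/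
def ehrhartSeries {d : ℕ} (P : Set (Fin d → ℝ)) : MvPowerSeries (Fin 2) ℤ :=
  fun e => PowerSeries.coeff (e 1) (gradedCount P (e 0))

/-- The graded Ehrhart series `Ẽ_P(t,q) = ∑_{m ≥ 1} ĩ_P(m;q) tᵐ` of the interior. -/
def interiorEhrhartSeries {d : ℕ} (P : Set (Fin d → ℝ)) : MvPowerSeries (Fin 2) ℤ :=
  fun e => if e 0 = 0 then 0 else PowerSeries.coeff (e 1) (gradedInteriorCount P (e 0))

/-! ## Unimodular zonotopes -/

/-- A `d × n` integer matrix of full rank `d` all of whose maximal minors are `-1`, `0` or `1`. -/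
def IsUnimodularMatrix {d n : ℕ} (A : Matrix (Fin d) (Fin n) ℤ) : Prop :=
  (A.map (Int.cast : ℤ → ℝ)).rank = d ∧
    ∀ c : Fin d ↪o Fin n, (A.submatrix id c).det ∈ ({-1, 0, 1} : Set ℤ)

/-- The zonotope `A · [0,1]ⁿ` in `ℝᵈ`. -/
def zonotope {d n : ℕ} (A : Matrix (Fin d) (Fin n) ℤ) : Set (Fin d → ℝ) :=
  (fun x => (A.map (Int.cast : ℤ → ℝ)).mulVec x) '' Set.Icc (0 : Fin n → ℝ) 1

/-! ## Rational functions in `t` and `q` -/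

/-- The field `ℚ(t,q)`. -/
abbrev RatTQ : Type := FractionRing (MvPolynomial (Fin 2) ℚ)

namespace RatTQ

/-- The variable `t`. -/
def t : RatTQ := algebraMap (MvPolynomial (Fin 2) ℚ) RatTQ (MvPolynomial.X 0)

/-- The variable `q`. -/
def q : RatTQ := algebraMap (MvPolynomial (Fin 2) ℚ) RatTQ (MvPolynomial.X 1)

/-- An integer polynomial in `t` (index `0`) and `q` (index `1`) as an element of `ℚ(t,q)`. -/
def ofPoly (N : MvPolynomial (Fin 2) ℤ) : RatTQ := MvPolynomial.aeval ![t, q] N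

/-- The formal power series `F` is (the expansion of) the rational function `r`:
`r = N / D` with `D ≠ 0` and `D · F = N`. -/
def IsExpansion (F : MvPowerSeries (Fin 2) ℤ) (r : RatTQ) : Prop :=
  ∃ N D : MvPolynomial (Fin 2) ℤ, D ≠ 0 ∧
    (D : MvPowerSeries (Fin 2) ℤ) * F = (N : MvPowerSeries (Fin 2) ℤ) ∧ r = ofPoly N / ofPoly D

/-- The substitution `p(t,q) ↦ p(t⁻¹,q⁻¹)` on polynomials. -/
def invVarsPoly : MvPolynomial (Fin 2) ℚ →ₐ[ℚ] RatTQ := MvPolynomial.aeval ![t⁻¹, q⁻¹]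

theorem t_ne_zero : t ≠ 0 := by
  simp [t]

theorem q_ne_zero : q ≠ 0 := by
  simp [q]

theorem invVarsPoly_injective : Function.Injective invVarsPoly := by
  rw [injective_iff_map_eq_zero]
  intro p hp
  set N := p.totalDegree with hN
  have hle : ∀ e ∈ p.support, ∀ i : Fin 2, e i ≤ N := fun e he i =>
    (Finsupp.le_degree i e).trans (MvPolynomial.le_totalDegree he)
  let r : (Fin 2 →₀ ℕ) → (Fin 2 →₀ ℕ) := fun e => Finsupp.equivFunOnFinite.symm fun i => N - e i
  have hr : ∀ e i, r e i = N - e i := fun e i => rfl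
  let P : MvPolynomial (Fin 2) ℚ := ∑ e ∈ p.support, MvPolynomial.monomial (r e) (p.coeff e)
  have hP : MvPolynomial.aeval ![t, q] P = (t * q) ^ N * invVarsPoly p := by
    rw [invVarsPoly, MvPolynomial.aeval_def ![t⁻¹, q⁻¹] p, MvPolynomial.eval₂_eq',
      Finset.mul_sum, map_sum]
    refine Finset.sum_congr rfl fun e he => ?_
    rw [MvPolynomial.aeval_monomial, Finsupp.prod_fintype _ _ (by simp)]
    have ht := t_ne_zero
    have hq := q_ne_zero
    have h0 := hle e he 0
    have h1 := hle e he 1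
    simp only [Fin.prod_univ_two, hr, Matrix.cons_val_zero, Matrix.cons_val_one, inv_pow,
      pow_sub₀ _ ht h0, pow_sub₀ _ hq h1]
    ring
  have hA : ∀ f : MvPolynomial (Fin 2) ℚ,
      MvPolynomial.aeval ![t, q] f = algebraMap (MvPolynomial (Fin 2) ℚ) RatTQ f := by
    intro f
    have : (MvPolynomial.aeval ![t, q] : MvPolynomial (Fin 2) ℚ →ₐ[ℚ] RatTQ) =
        IsScalarTower.toAlgHom ℚ (MvPolynomial (Fin 2) ℚ) RatTQ := by
      ext i
      fin_cases i <;> simp [t, q]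
    rw [this]
    rfl
  have hP0 : P = 0 := by
    rw [hp, mul_zero, hA] at hP
    exact (map_eq_zero_iff _ (IsFractionRing.injective _ _)).1 hP
  by_contra hne
  obtain ⟨e, he⟩ := MvPolynomial.support_nonempty.2 hne
  have hc : P.coeff (r e) = p.coeff e := by
    rw [MvPolynomial.coeff_sum, Finset.sum_eq_single e]
    · simp
    · intro e' he' hne'
      rw [MvPolynomial.coeff_monomial, if_neg]
      intro h
      apply hne'
      ext i
      have h2 := DFunLike.congr_fun h i
      rw [hr, hr] at h2
      have h3 := hle e he i
      have h4 := hle e' he' i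
      omega
    · intro h
      exact absurd he h
  rw [hP0, MvPolynomial.coeff_zero] at hc
  exact MvPolynomial.mem_support_iff.1 he hc.symm

/-- The substitution `r(t,q) ↦ r(t⁻¹,q⁻¹)` on rational functions. -/
def invVars : RatTQ →ₐ[ℚ] RatTQ := IsFractionRing.liftAlgHom invVarsPoly_injective

theorem invVars_t : invVars t = t⁻¹ := by
  simp [invVars, IsFractionRing.liftAlgHom_apply, t, invVarsPoly]

theorem invVars_q : invVars q = q⁻¹ := by
  simp [invVars, IsFractionRing.liftAlgHom_apply, q, invVarsPoly]

end RatTQ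

end

/-!
Let `V = ℤᵈ` and let `aᵢ` be the columns of `A`. The coefficient of `qʲ` in the Hilbert series of
`Orb(S)`, for a set `S` of lattice points, is the increase from degree `< j` to degree `≤ j` of the
dimension of the space of polynomial functions on `S` of bounded degree (`orbHilb_eq`). Polynomial
functions on `V` are the functions killed by iterated differences (`map_polyLT`), and in this form
they are accessible to deletion and contraction.

*Facets.* The lattice points of the zonotope with `μ i` copies of the segment `[0, aᵢ]`, or those of
its interior, form a region `{y | ∀ h, h y ≤ b h}`, where `h` runs through the nonzero integral
functionals with values in `{-1, 0, 1}` on the columns. Indeed, unimodularity provides for every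
integral functional a sign-conformal functional of this kind (`exists_conformal_unit`), so the
inequalities for these functionals imply those for all others (`le_supportBound_of_unit`). The same
fact shows that projecting along a column maps the lattice points of a region onto those of the
contracted region (`isAdmissible_zonotope`).

*Deletion and contraction.* Contraction of a set `T` of columns is modelled by restricting to
functions invariant under translation by the columns in `T`, and to functionals vanishing on them.
The difference operator of a column `v` outside the span of `T` maps the functions of degree `≤ k`
vanishing on a region to functions of degree `< k` vanishing on the region with one copy of `v`
deleted; its kernel consists of the functions vanishing on the region contracted by `v`. The
operator is surjective here because the functions vanishing on a region are sums of functions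
vanishing on a slab `{-b (-h) ≤ h ≤ b h}` (`slabGenerated_zonotope`), and on a slab an
antidifference with the correct boundary values is explicit (`slabSum_lower_le`). Slab generation
is in turn proved by induction with the same operators (`SlabGenerated.of_lower_of_contract`).
Counting dimensions, the graded counts `F(μ, T)` satisfy `F(μ + e_v, T) = q F(μ, T) + F(μ, T ∪ {v})`
(`zonotopeSeries_add_single`), for the closed zonotope and for the interior.

*Reciprocity.* Solving the recursion column by column shows that the closed count of the `m`-th
dilate is `P(q ^ m)` for a polynomial `P` of degree at most `n` over `ℚ(q)`, and that the interior
count is `(-1/q) ^ d P*(q ^ m)` for `m ≥ 1`, where `P*` arises from `P` by inverting `q` in the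
coefficients (`exists_isCountingPolynomial`). Hence the two series are the sums of
`cⱼ / (1 - t qʲ)` and of `t (-1/q) ^ d cⱼ* qʲ / (1 - t qʲ)`, where `cⱼ` are the coefficients of `P`.
This gives the denominators (`exists_expansion`), and the two sums correspond term by term under the
inversion of `t` and `q` (`reciprocity_term`).
-/

namespace GradedEhrhart

/-! ### Polynomial functions and finite differences -/

section Difference

variable {V : Type*} [AddCommGroup V]

/-- The forward difference `f ↦ (x ↦ f (x + w) - f x)` as a `ℂ`-linear map. -/
def diffMap (w : V) : (V → ℂ) →ₗ[ℂ] (V → ℂ) where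
  toFun := fwdDiff w
  map_add' := fwdDiff_add w
  map_smul' c f := fwdDiff_const_smul w c f

theorem diffMap_apply (w : V) (f : V → ℂ) (x : V) : diffMap w f x = f (x + w) - f x := rfl

/-- The functions killed by all products of `k` forward differences. On `ℤᵈ` these are the
restrictions of the polynomials of degree less than `k`. -/
def polyFun (V : Type*) [AddCommGroup V] : ℕ → Submodule ℂ (V → ℂ)
  | 0 => ⊥
  | k + 1 => ⨅ w : V, (polyFun V k).comap (diffMap w)

@[simp] theorem mem_polyFun_zero {f : V → ℂ} : f ∈ polyFun V 0 ↔ f = 0 := Iff.rfl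

theorem mem_polyFun_succ {k : ℕ} {f : V → ℂ} :
    f ∈ polyFun V (k + 1) ↔ ∀ w, diffMap w f ∈ polyFun V k := by
  simp [polyFun, Submodule.mem_iInf]

theorem polyFun_le_succ (k : ℕ) : polyFun V k ≤ polyFun V (k + 1) := by
  induction k with
  | zero => simp [polyFun]
  | succ k ih => exact fun f hf => mem_polyFun_succ.2 fun w => ih (mem_polyFun_succ.1 hf w)

theorem polyFun_translate {k : ℕ} {f : V → ℂ} (hf : f ∈ polyFun V k) (s : V) :
    (fun x => f (x + s)) ∈ polyFun V k := by
  have : (fun x => f (x + s)) = f + diffMap s f := by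
    ext x
    simp [diffMap_apply]
  rw [this]
  cases k with
  | zero => simp_all
  | succ k => exact add_mem hf (polyFun_le_succ k (mem_polyFun_succ.1 hf s))

theorem polyFun_one_const {f : V → ℂ} (hf : f ∈ polyFun V 1) (x : V) : f x = f 0 := by
  have := congrFun (mem_polyFun_succ.1 hf x : diffMap x f = 0) 0
  simpa [diffMap_apply, sub_eq_zero] using this

theorem const_mem_polyFun (c : ℂ) (k : ℕ) : (fun _ => c) ∈ polyFun V (k + 1) := by
  rw [mem_polyFun_succ]
  intro w
  have : diffMap w (fun _ => c) = 0 := by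
    ext x
    simp [diffMap_apply]
  rw [this]
  exact zero_mem _

theorem diffMap_zsmul_mem {k : ℕ} {f : V → ℂ} {v : V} (hf : diffMap v f ∈ polyFun V k) (j : ℤ) :
    diffMap (j • v) f ∈ polyFun V k := by
  induction j using Int.induction_on with
  | zero =>
    have : diffMap ((0 : ℤ) • v) f = 0 := by
      ext x
      simp [diffMap_apply]
    rw [this]
    exact zero_mem _
  | succ i ih =>
    have : diffMap (((i : ℤ) + 1) • v) f =
        diffMap ((i : ℤ) • v) f + fun x => diffMap v f (x + (i : ℤ) • v) := by
      ext x
      simp [diffMap_apply, add_smul, add_assoc]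
    rw [this]
    exact add_mem ih (polyFun_translate hf _)
  | pred i ih =>
    have : diffMap ((-(i : ℤ) - 1) • v) f =
        diffMap (-(i : ℤ) • v) f - fun x => diffMap v f (x + (-(i : ℤ) - 1) • v) := by
      ext x
      simp [diffMap_apply, sub_smul, add_assoc]
    rw [this]
    exact sub_mem ih (polyFun_translate hf _)

/-- The product of `f` of degree less than `k + 1` and `g` of degree less than `l + 1` has degree
less than `k + l + 1`. -/
theorem mul_mem_polyFun {k l : ℕ} {f g : V → ℂ} (hf : f ∈ polyFun V (k + 1))
    (hg : g ∈ polyFun V (l + 1)) : f * g ∈ polyFun V (k + l + 1) := by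
  induction hs : k + l generalizing k l f g with
  | zero =>
    obtain ⟨rfl, rfl⟩ : k = 0 ∧ l = 0 := by omega
    have : f * g = fun _ => f 0 * g 0 := by
      ext x
      simp [polyFun_one_const hf x, polyFun_one_const hg x]
    rw [this]
    exact const_mem_polyFun _ _
  | succ s ih =>
    rw [mem_polyFun_succ]
    intro w
    have : diffMap w (f * g) = diffMap w f * (fun x => g (x + w)) + f * diffMap w g := by
      ext x
      simp [diffMap_apply]
      ring
    rw [this]
    refine add_mem ?_ ?_
    · cases k with
      | zero =>
        rw [show diffMap w f = 0 from mem_polyFun_succ.1 hf w]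
        simp
      | succ k =>
        exact ih (mem_polyFun_succ.1 hf w) (polyFun_translate hg w) (by omega)
    · cases l with
      | zero =>
        rw [show diffMap w g = 0 from mem_polyFun_succ.1 hg w]
        simp
      | succ l =>
        exact ih hf (mem_polyFun_succ.1 hg w) (by omega)

/-- The antidifference of a sequence on `ℤ`, normalised to vanish at `0`. -/
noncomputable def intSum (u : ℤ → ℂ) (n : ℤ) : ℂ :=
  ∑ i ∈ Finset.Ico 0 n, u i - ∑ i ∈ Finset.Ico n 0, u i

theorem intSum_succ (u : ℤ → ℂ) (n : ℤ) : intSum u (n + 1) = intSum u n + u n := by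
  unfold intSum
  rcases le_or_gt 0 n with h | h
  · rw [Finset.Ico_eq_empty_of_le (show (0 : ℤ) ≤ n + 1 by omega), Finset.Ico_eq_empty_of_le h,
      ← Finset.insert_Ico_right_eq_Ico_add_one h, Finset.sum_insert (by simp)]
    simp [add_comm]
  · rw [Finset.Ico_eq_empty_of_le (show n + 1 ≤ 0 by omega), Finset.Ico_eq_empty_of_le h.le,
      ← Finset.insert_Ico_add_one_left_eq_Ico h, Finset.sum_insert (by simp)]
    simp

/-- The antidifference of `f` in the direction `v`, normalised to vanish on `h = s`, where `h` is
an additive functional with `h v = 1`. -/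
noncomputable def antidiff (h : V →+ ℤ) (v : V) (s : ℤ) : (V → ℂ) →ₗ[ℂ] (V → ℂ) where
  toFun f x := intSum (fun i => f (x + (s + i - h x) • v)) (h x - s)
  map_add' f g := by
    ext x
    simp only [intSum, Pi.add_apply, Finset.sum_add_distrib]
    ring
  map_smul' c f := by
    ext x
    simp only [intSum, Pi.smul_apply, smul_eq_mul, RingHom.id_apply, ← Finset.mul_sum]
    ring

theorem antidiff_apply (h : V →+ ℤ) (v : V) (s : ℤ) (f : V → ℂ) (x : V) :
    antidiff h v s f x = intSum (fun i => f (x + (s + i - h x) • v)) (h x - s) := rfl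

theorem diffMap_antidiff {h : V →+ ℤ} {v : V} (hv : h v = 1) (s : ℤ) (f : V → ℂ) :
    diffMap v (antidiff h v s f) = f := by
  ext x
  rw [diffMap_apply, antidiff_apply, antidiff_apply]
  have h1 : (fun i => f (x + v + (s + i - h (x + v)) • v)) =
      fun i => f (x + (s + i - h x) • v) := by
    ext i
    congr 1
    rw [map_add, hv]
    module
  rw [h1, map_add, hv, show h x + 1 - s = h x - s + 1 by ring, intSum_succ]
  simp

theorem antidiff_translate {h : V →+ ℤ} {v c : V} (hc : h c = 0) (s : ℤ) (f : V → ℂ) (x : V) :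
    antidiff h v s f (x + c) = antidiff h v s (fun y => f (y + c)) x := by
  simp only [antidiff_apply, map_add, hc, add_zero, add_right_comm]

theorem antidiff_mem {h : V →+ ℤ} {v : V} (hv : h v = 1) (s : ℤ) {k : ℕ} {f : V → ℂ}
    (hf : f ∈ polyFun V k) : antidiff h v s f ∈ polyFun V (k + 1) := by
  induction k generalizing f with
  | zero =>
    rw [mem_polyFun_zero.1 hf, map_zero]
    exact zero_mem _
  | succ k ih =>
    rw [mem_polyFun_succ]
    intro w
    -- split `w` into its component along `v` and its component in the kernel of `h`
    set w₀ := w - h w • v with hw₀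
    have h0 : h w₀ = 0 := by simp [hw₀, hv]
    have hsplit : diffMap w (antidiff h v s f) =
        (fun x => diffMap (h w • v) (antidiff h v s f) (x + w₀)) +
          antidiff h v s (diffMap w₀ f) := by
      have h2 : antidiff h v s (diffMap w₀ f) = diffMap w₀ (antidiff h v s f) := by
        ext x
        rw [show diffMap w₀ f = (fun y => f (y + w₀)) - f from rfl, map_sub, Pi.sub_apply,
          diffMap_apply, antidiff_translate h0]
      rw [h2]
      ext x
      simp only [Pi.add_apply, diffMap_apply]
      rw [show x + w₀ + h w • v = x + w by rw [hw₀]; abel]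
      ring
    rw [hsplit]
    refine add_mem (polyFun_translate (diffMap_zsmul_mem ?_ _) _) (ih (mem_polyFun_succ.1 hf w₀))
    rw [diffMap_antidiff hv]
    exact hf

end Difference

/-! ### Deletion and contraction for regions cut out by slabs -/

section Slab

variable {V : Type*} [AddCommGroup V]

/-- The points satisfying the inequalities `h y ≤ b h` for all functionals `h` in `H`. -/
def region (H : Set (V →+ ℤ)) (b : (V →+ ℤ) → ℤ) : Set V := {y | ∀ h ∈ H, h y ≤ b h}

/-- The functions invariant under translation by the elements of `C`. -/
def invariantFun (C : Set V) : Submodule ℂ (V → ℂ) where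
  carrier := {f | ∀ c ∈ C, ∀ x, f (x + c) = f x}
  add_mem' hf hg c hc x := by simp [hf c hc x, hg c hc x]
  zero_mem' _ _ _ := rfl
  smul_mem' r f hf c hc x := by simp [hf c hc x]

/-- The `C`-invariant polynomial functions of degree less than `k`. -/
def invPoly (C : Set V) (k : ℕ) : Submodule ℂ (V → ℂ) := polyFun V k ⊓ invariantFun C

/-- The functions vanishing on `S`. -/
def vanishing (S : Set V) : Submodule ℂ (V → ℂ) where
  carrier := {f | ∀ y ∈ S, f y = 0}
  add_mem' hf hg y hy := by simp [hf y hy, hg y hy]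
  zero_mem' _ _ := rfl
  smul_mem' r f hf y hy := by simp [hf y hy]

/-- The points on which `h` takes a value permitted by the bounds on `h` and `-h`. -/
def slab (b : (V →+ ℤ) → ℤ) (h : V →+ ℤ) : Set V := {y | -b (-h) ≤ h y ∧ h y ≤ b h}

/-- The sum over `h ∈ H` of the spaces of invariant polynomial functions of degree less than `k`
which vanish on the slab of `h`. -/
def slabSum (H : Set (V →+ ℤ)) (b : (V →+ ℤ) → ℤ) (C : Set V) (k : ℕ) : Submodule ℂ (V → ℂ) :=
  ⨆ h ∈ H, invPoly C k ⊓ vanishing (slab b h)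

/-- Every invariant polynomial function that vanishes on the region is a sum, without increase of
the degree, of functions that already vanish on one of the slabs containing the region. -/
def SlabGenerated (H : Set (V →+ ℤ)) (b : (V →+ ℤ) → ℤ) (C : Set V) : Prop :=
  ∀ k, invPoly C k ⊓ vanishing (region H b) ≤ slabSum H b C k

/-- The bounds after deletion of one copy of the generator `v`. -/
def lower (b : (V →+ ℤ) → ℤ) (v : V) (h : V →+ ℤ) : ℤ := b h - if h v = 1 then 1 else 0

/-- The functionals that survive the contraction of `v`. -/
def contract (H : Set (V →+ ℤ)) (v : V) : Set (V →+ ℤ) := {h ∈ H | h v = 0}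

/-- The conditions on a direction `v` under which deletion and contraction of `v` are related by an
exact sequence. The last one says that the region maps onto the contracted region. -/
structure IsAdmissible (H : Set (V →+ ℤ)) (b : (V →+ ℤ) → ℤ) (C : Set V) (v : V) : Prop where
  neg_mem : ∀ h ∈ H, -h ∈ H
  invariant : ∀ h ∈ H, ∀ c ∈ C, h c = 0
  unit : ∀ h ∈ H, h v = 0 ∨ h v = 1 ∨ h v = -1
  nonloop : ∃ h ∈ H, h v = 1
  lift : ∀ y ∈ region (contract H v) b, ∃ k : ℤ, y + k • v ∈ region H b

variable {H : Set (V →+ ℤ)} {b : (V →+ ℤ) → ℤ} {C : Set V} {v : V}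

theorem mem_invPoly {k : ℕ} {f : V → ℂ} :
    f ∈ invPoly C k ↔ f ∈ polyFun V k ∧ ∀ c ∈ C, ∀ x, f (x + c) = f x := Iff.rfl

theorem mem_vanishing {W : Type*} {S : Set W} {f : W → ℂ} :
    f ∈ vanishing S ↔ ∀ y ∈ S, f y = 0 := Iff.rfl

theorem region_subset_slab (hneg : ∀ h ∈ H, -h ∈ H) {h : V →+ ℤ} (hh : h ∈ H) :
    region H b ⊆ slab b h := fun y hy => by
  have := hy _ (hneg h hh)
  rw [AddMonoidHom.neg_apply] at this
  exact ⟨by omega, hy h hh⟩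

theorem slab_neg (b : (V →+ ℤ) → ℤ) (h : V →+ ℤ) : slab b (-h) = slab b h := by
  ext y
  simp only [slab, Set.mem_ofPred_eq, neg_neg, AddMonoidHom.neg_apply]
  omega

theorem slabSum_le (hneg : ∀ h ∈ H, -h ∈ H) (k : ℕ) :
    slabSum H b C k ≤ invPoly C k ⊓ vanishing (region H b) :=
  iSup₂_le fun _ hh => le_inf inf_le_left
    (inf_le_right.trans fun _ hf y hy => hf y (region_subset_slab hneg hh hy))

theorem le_slabSum {h : V →+ ℤ} (hh : h ∈ H) {k : ℕ} {f : V → ℂ} (hf : f ∈ invPoly C k)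
    (hv : f ∈ vanishing (slab b h)) : f ∈ slabSum H b C k :=
  Submodule.mem_iSup_of_mem h (Submodule.mem_iSup_of_mem hh ⟨hf, hv⟩)

theorem SlabGenerated.of_slab_eq_empty {h : V →+ ℤ} (hh : h ∈ H) (hb : b h + b (-h) < 0) :
    SlabGenerated H b C := fun _ _ hf => le_slabSum hh hf.1 fun y hy => by
  have h1 := hy.1
  have h2 := hy.2
  omega

theorem region_eq_empty (hneg : ∀ h ∈ H, -h ∈ H) {h : V →+ ℤ} (hh : h ∈ H)
    (hb : b h + b (-h) < 0) : region H b = ∅ := by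
  refine Set.eq_empty_of_forall_notMem fun y hy => ?_
  have h1 := (region_subset_slab hneg hh hy).1
  have h2 := (region_subset_slab hneg hh hy).2
  omega

theorem intSum_eq_zero {u : ℤ → ℂ} {n : ℤ} (hn : 0 ≤ n) (hu : ∀ i, 0 ≤ i → i < n → u i = 0) :
    intSum u n = 0 := by
  rw [intSum, Finset.Ico_eq_empty_of_le hn, Finset.sum_empty, sub_zero]
  exact Finset.sum_eq_zero fun i hi => hu i (Finset.mem_Ico.1 hi).1 (Finset.mem_Ico.1 hi).2

theorem antidiff_mem_invPoly {h : V →+ ℤ} (hC : ∀ c ∈ C, h c = 0) (hv : h v = 1) (s : ℤ) {k : ℕ}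
    {f : V → ℂ} (hf : f ∈ invPoly C k) : antidiff h v s f ∈ invPoly C (k + 1) := by
  refine ⟨antidiff_mem hv s hf.1, fun c hc x => ?_⟩
  rw [antidiff_translate (hC c hc), show (fun y => f (y + c)) = f from funext (hf.2 c hc)]

/-- Antidifferences can be chosen compatibly with slabs: lowering the bounds by one copy of `v`
shortens each slab by exactly one step if `v` crosses it. -/
theorem slabSum_lower_le (hA : IsAdmissible H b C v) (k : ℕ) :
    slabSum H (lower b v) C k ≤ (slabSum H b C (k + 1)).map (diffMap v) := by
  have crossing : ∀ h ∈ H, h v = 1 → invPoly C k ⊓ vanishing (slab (lower b v) h) ≤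
      (slabSum H b C (k + 1)).map (diffMap v) := by
    rintro h hh hv f ⟨hf, hf0⟩
    refine ⟨antidiff h v (-b (-h)) f,
      le_slabSum hh (antidiff_mem_invPoly (hA.invariant h hh) hv _ hf) fun y hy => ?_,
      diffMap_antidiff hv _ _⟩
    have h1 := hy.1
    have h2 := hy.2
    rw [antidiff_apply]
    refine intSum_eq_zero (by omega) fun i hi0 hi => hf0 _ ?_
    simp only [slab, lower, Set.mem_ofPred_eq, map_add, map_zsmul, hv, AddMonoidHom.neg_apply,
      smul_eq_mul]
    norm_num
    omega
  refine iSup₂_le fun h hh => ?_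
  rcases hA.unit h hh with hv | hv | hv
  · rintro f ⟨hf, hf0⟩
    obtain ⟨h₀, hh₀, hv₀⟩ := hA.nonloop
    refine ⟨antidiff h₀ v 0 f,
      le_slabSum hh (antidiff_mem_invPoly (hA.invariant h₀ hh₀) hv₀ _ hf) fun y hy => ?_,
      diffMap_antidiff hv₀ _ _⟩
    have : ∀ j : ℤ, f (y + j • v) = 0 := fun j => hf0 _ (by
      simpa [slab, lower, hv] using hy)
    simp [antidiff_apply, intSum, this]
  · exact crossing h hh hv
  · rw [← slab_neg]
    exact crossing (-h) (hA.neg_mem h hh) (by simp [hv])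

/-- A polynomial function whose difference in the direction `v` vanishes is invariant under `v`. -/
theorem mem_invPoly_insert {k : ℕ} {f : V → ℂ} :
    f ∈ invPoly (insert v C) k ↔ f ∈ invPoly C k ∧ diffMap v f = 0 := by
  have : diffMap v f = 0 ↔ ∀ x, f (x + v) = f x := by
    rw [funext_iff]
    simp [diffMap_apply, sub_eq_zero]
  rw [mem_invPoly, mem_invPoly, this, Set.forall_mem_insert]
  tauto

theorem invariant_zsmul {f : V → ℂ} (hf : ∀ x, f (x + v) = f x) (k : ℤ) (x : V) :
    f (x + k • v) = f x := by
  induction k using Int.induction_on with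
  | zero => simp
  | succ i ih => rw [add_smul, one_smul, ← add_assoc, hf, ih]
  | pred i ih =>
    rw [← ih, ← hf (x + (-(i : ℤ) - 1) • v), add_assoc, ← add_one_zsmul, sub_add_cancel]

/-- On functions invariant under `v`, vanishing on the region and on the contracted region is the
same. -/
theorem vanishing_contract (hA : IsAdmissible H b C v) {f : V → ℂ} (hf : ∀ x, f (x + v) = f x) :
    f ∈ vanishing (region (contract H v) b) ↔ f ∈ vanishing (region H b) := by
  refine ⟨fun h y hy => h y fun g hg => hy g hg.1, fun h y hy => ?_⟩
  obtain ⟨k, hk⟩ := hA.lift y hy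
  rw [← invariant_zsmul hf k, h _ hk]

theorem diffMap_mem_vanishing_lower (hA : IsAdmissible H b C v) {f : V → ℂ}
    (hf : f ∈ vanishing (region H b)) : diffMap v f ∈ vanishing (region H (lower b v)) := by
  intro y hy
  rw [diffMap_apply, hf y, hf (y + v), sub_zero]
  · intro h hh
    have := hy h hh
    rw [lower] at this
    rw [map_add]
    rcases hA.unit h hh with hv | hv | hv <;> simp [hv] at this ⊢ <;> omega
  · intro h hh
    have := hy h hh
    rw [lower] at this
    split_ifs at this <;> omega

theorem diffMap_mem_invPoly {k : ℕ} {f : V → ℂ} (hf : f ∈ invPoly C (k + 1)) (w : V) :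
    diffMap w f ∈ invPoly C k := by
  refine ⟨mem_polyFun_succ.1 hf.1 w, fun c hc x => ?_⟩
  rw [diffMap_apply, diffMap_apply, add_right_comm, hf.2 c hc, hf.2 c hc]

/-- Slab generation passes from the deletion and the contraction to the original region. -/
theorem SlabGenerated.of_lower_of_contract (hA : IsAdmissible H b C v)
    (hdel : SlabGenerated H (lower b v) C)
    (hcon : SlabGenerated (contract H v) b (insert v C)) : SlabGenerated H b C := by
  rintro (_ | k) f ⟨hf, hf0⟩
  · rw [show f = 0 from hf.1]
    exact zero_mem _
  · obtain ⟨g, hg, hgf⟩ := slabSum_lower_le hA k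
      (hdel k ⟨diffMap_mem_invPoly hf v, diffMap_mem_vanishing_lower hA hf0⟩)
    have hg' := slabSum_le hA.neg_mem (k + 1) hg
    have hfg : f - g ∈ invPoly (insert v C) (k + 1) :=
      mem_invPoly_insert.2 ⟨sub_mem hf hg'.1, by rw [map_sub, hgf, sub_self]⟩
    have hle : slabSum (contract H v) b (insert v C) (k + 1) ≤ slabSum H b C (k + 1) :=
      iSup₂_le fun h hh q hq => le_slabSum hh.1 (mem_invPoly_insert.1 hq.1).1 hq.2
    have := hle (hcon (k + 1) ⟨hfg, (vanishing_contract hA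
      (hfg.2 v (Set.mem_insert v C))).2 (sub_mem hf0 hg'.2)⟩)
    simpa using add_mem this hg

/-- The dimension of the space of restrictions to the region of the invariant polynomial functions
of degree less than `k`. -/
noncomputable def regionDim (H : Set (V →+ ℤ)) (b : (V →+ ℤ) → ℤ) (C : Set V) (k : ℕ) : ℕ :=
  Module.finrank ℂ ((invPoly C k).map (LinearMap.funLeft ℂ ℂ ((↑) : region H b → V)))

theorem finrank_map_add_finrank_inf_ker {E F : Type*} [AddCommGroup E] [Module ℂ E]
    [AddCommGroup F] [Module ℂ F] (p : Submodule ℂ E) [FiniteDimensional ℂ p] (φ : E →ₗ[ℂ] F) :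
    Module.finrank ℂ (p.map φ) + Module.finrank ℂ (p ⊓ LinearMap.ker φ : Submodule ℂ E) =
      Module.finrank ℂ p := by
  rw [← LinearMap.finrank_range_add_finrank_ker (φ.domRestrict p), LinearMap.range_domRestrict]
  rw [LinearMap.ker_domRestrict, ← Submodule.map_comap_subtype, Submodule.finrank_map_subtype_eq]

theorem ker_funLeft_coe {W : Type*} (S : Set W) :
    LinearMap.ker (LinearMap.funLeft ℂ ℂ ((↑) : S → W)) = vanishing S := by
  ext f
  rw [LinearMap.mem_ker, funext_iff]
  simp [LinearMap.funLeft_apply, mem_vanishing]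

theorem regionDim_add [∀ k, FiniteDimensional ℂ (polyFun V k)] (H : Set (V →+ ℤ))
    (b : (V →+ ℤ) → ℤ) (C : Set V) (k : ℕ) :
    regionDim H b C k +
        Module.finrank ℂ (invPoly C k ⊓ vanishing (region H b) : Submodule ℂ (V → ℂ)) =
      Module.finrank ℂ (invPoly C k) := by
  have : FiniteDimensional ℂ (invPoly C k) := Submodule.finiteDimensional_inf_left _ _
  rw [regionDim, ← finrank_map_add_finrank_inf_ker (invPoly C k)
    (LinearMap.funLeft ℂ ℂ ((↑) : region H b → V)), ker_funLeft_coe]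

theorem regionDim_zero (H : Set (V →+ ℤ)) (b : (V →+ ℤ) → ℤ) (C : Set V) :
    regionDim H b C 0 = 0 := by
  rw [regionDim, show invPoly C 0 = ⊥ from bot_inf_eq _, Submodule.map_bot, finrank_bot]

theorem regionDim_of_region_eq_empty (h : region H b = ∅) (k : ℕ) : regionDim H b C k = 0 := by
  have : IsEmpty (region H b) := Set.isEmpty_coe_sort.2 h
  exact Module.finrank_zero_of_subsingleton

/-- The deletion-contraction recursion for the dimensions: `v`-differences map the functions on the
region onto those on the deleted region, with kernel the functions on the contracted region. -/
theorem regionDim_succ [∀ k, FiniteDimensional ℂ (polyFun V k)] (hA : IsAdmissible H b C v)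
    (hdel : SlabGenerated H (lower b v) C) (k : ℕ) :
    regionDim H b C (k + 1) =
      regionDim H (lower b v) C k + regionDim (contract H v) b (insert v C) (k + 1) := by
  have fin : ∀ (C : Set V) (k : ℕ), FiniteDimensional ℂ (invPoly C k) := fun C k =>
    Submodule.finiteDimensional_inf_left _ _
  have fin' : FiniteDimensional ℂ
      (invPoly C (k + 1) ⊓ vanishing (region H b) : Submodule ℂ (V → ℂ)) :=
    Submodule.finiteDimensional_inf_left _ _
  have hker : ∀ p : Submodule ℂ (V → ℂ), invPoly C (k + 1) ⊓ p ⊓ LinearMap.ker (diffMap v) =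
      invPoly (insert v C) (k + 1) ⊓ p := fun p => by
    ext f
    simp only [Submodule.mem_inf, mem_invPoly_insert, LinearMap.mem_ker]
    tauto
  have e1 : (invPoly C (k + 1)).map (diffMap v) = invPoly C k := by
    refine le_antisymm (Submodule.map_le_iff_le_comap.2 fun f hf => diffMap_mem_invPoly hf v)
      fun f hf => ?_
    obtain ⟨h₀, hh₀, hv₀⟩ := hA.nonloop
    exact ⟨_, antidiff_mem_invPoly (hA.invariant h₀ hh₀) hv₀ 0 hf, diffMap_antidiff hv₀ _ _⟩
  have e2 : (invPoly C (k + 1) ⊓ vanishing (region H b)).map (diffMap v) =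
      invPoly C k ⊓ vanishing (region H (lower b v)) :=
    le_antisymm (Submodule.map_le_iff_le_comap.2 fun f hf =>
        ⟨diffMap_mem_invPoly hf.1 v, diffMap_mem_vanishing_lower hA hf.2⟩)
      ((hdel k).trans ((slabSum_lower_le hA k).trans
        (Submodule.map_mono (slabSum_le hA.neg_mem (k + 1)))))
  have e3 : invPoly (insert v C) (k + 1) ⊓ vanishing (region H b) =
      invPoly (insert v C) (k + 1) ⊓ vanishing (region (contract H v) b) := by
    ext f
    exact and_congr_right fun hf => (vanishing_contract hA (hf.2 v (Set.mem_insert v C))).symm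
  have r1 := finrank_map_add_finrank_inf_ker (invPoly C (k + 1)) (diffMap v)
  have r2 := finrank_map_add_finrank_inf_ker
    (invPoly C (k + 1) ⊓ vanishing (region H b)) (diffMap v)
  have hk := hker ⊤
  rw [inf_top_eq, inf_top_eq] at hk
  rw [e1, hk] at r1
  rw [e2, hker, e3] at r2
  have d1 := regionDim_add H b C (k + 1)
  have d2 := regionDim_add H (lower b v) C k
  have d3 := regionDim_add (contract H v) b (insert v C) (k + 1)
  omega

end Slab

/-! ### Sign-conformal decompositions over unimodular matrices -/

section Conformal

variable {d n : ℕ} {A : Matrix (Fin d) (Fin n) ℤ}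

theorem det_submatrix_mem (hA : IsUnimodularMatrix A) (c : Fin d → Fin n) :
    (A.submatrix id c).det = 0 ∨ (A.submatrix id c).det = 1 ∨ (A.submatrix id c).det = -1 := by
  by_cases hc : Function.Injective c
  · have hmono : StrictMono (c ∘ Tuple.sort c) :=
      (Tuple.monotone_sort c).strictMono_of_injective (hc.comp (Tuple.sort c).injective)
    have h1 := hA.2 (OrderEmbedding.ofStrictMono _ hmono)
    have h2 : A.submatrix id (OrderEmbedding.ofStrictMono _ hmono) =
        (A.submatrix id c).submatrix id (Tuple.sort c) := rfl
    rw [h2, Matrix.det_permute'] at h1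
    rcases Int.units_eq_one_or (Equiv.Perm.sign (Tuple.sort c)) with h | h <;>
      simp [h] at h1 ⊢ <;> omega
  · left
    simp only [Function.Injective, not_forall] at hc
    obtain ⟨i, j, hij, hne⟩ := hc
    exact Matrix.det_zero_of_column_eq hne fun k => by simp [hij]

theorem exists_det_submatrix_ne_zero (hA : IsUnimodularMatrix A) :
    ∃ c : Fin d → Fin n, (A.submatrix id c).det ≠ 0 := by
  have hr := hA.1
  rw [Matrix.rank_eq_finrank_span_cols] at hr
  obtain ⟨f, hf, -, hli⟩ := Submodule.exists_fun_fin_finrank_span_eq ℝ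
    (Set.range (A.map (Int.cast : ℤ → ℝ)).col)
  choose c hc using hf
  set e : Fin d ≃ Fin (Module.finrank ℝ (Submodule.span ℝ
    (Set.range (A.map (Int.cast : ℤ → ℝ)).col))) := finCongr hr.symm
  have h1 : LinearIndependent ℝ ((A.submatrix id (c ∘ e)).map (Int.cast : ℤ → ℝ)).col := by
    have : ((A.submatrix id (c ∘ e)).map (Int.cast : ℤ → ℝ)).col = f ∘ e :=
      funext fun k => hc (e k)
    rw [this]
    exact hli.comp e e.injective
  rw [Matrix.linearIndependent_cols_iff_isUnit, Matrix.isUnit_iff_isUnit_det, isUnit_iff_ne_zero]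
    at h1
  refine ⟨c ∘ e, fun h0 => h1 ?_⟩
  have h2 := (Int.castRingHom ℝ).map_det (A.submatrix id (c ∘ e))
  rw [h0, map_zero] at h2
  exact h2.symm

/-- The values of `h` on the columns of `A` have the signs of those of `g` wherever they do not
vanish. -/
def Conformal (A : Matrix (Fin d) (Fin n) ℤ) (h g : (Fin d → ℤ) →+ ℤ) : Prop :=
  ∀ i, h (A.col i) = 0 ∨ 0 < h (A.col i) * g (A.col i)

theorem Conformal.refl (g : (Fin d → ℤ) →+ ℤ) : Conformal A g g := fun i => by
  rcases eq_or_ne (g (A.col i)) 0 with h | h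
  · exact Or.inl h
  · exact Or.inr (mul_self_pos.2 h)

theorem Conformal.trans {h g k : (Fin d → ℤ) →+ ℤ} (h₁ : Conformal A h g) (h₂ : Conformal A g k) :
    Conformal A h k := fun i => by
  rcases h₁ i with h0 | h0
  · exact Or.inl h0
  · rcases h₂ i with g0 | g0
    · simp [g0] at h0
    · refine Or.inr (pos_of_mul_pos_left (b := g (A.col i) ^ 2) ?_ (sq_nonneg _))
      nlinarith [mul_pos h0 g0]

/-- The functional `y ↦ det (B with column k replaced by y)`. -/
def cramerFunctional (B : Matrix (Fin d) (Fin d) ℤ) (k : Fin d) : (Fin d → ℤ) →+ ℤ :=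
  ((LinearMap.proj k).comp B.cramer).toAddMonoidHom

theorem cramerFunctional_col (c : Fin d → Fin n) (k : Fin d) (i : Fin n) :
    cramerFunctional (A.submatrix id c) k (A.col i) =
      (A.submatrix id (Function.update c k i)).det := by
  change (A.submatrix id c).cramer (A.col i) k = _
  rw [Matrix.cramer_apply]
  congr 1
  ext r s
  rcases eq_or_ne s k with rfl | hs
  · simp [Matrix.col]
  · simp [hs]

theorem eq_zero_of_forall_col {c : Fin d → Fin n} (hc : (A.submatrix id c).det ≠ 0)
    {h : (Fin d → ℤ) →+ ℤ} (h0 : ∀ k, h (A.col (c k)) = 0) : h = 0 := by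
  have key : ∀ y : Fin d → ℤ, h y = (fun i => h (Pi.single i 1)) ⬝ᵥ y := fun y => by
    conv_lhs => rw [← Finset.univ_sum_single y]
    rw [map_sum]
    refine Finset.sum_congr rfl fun i _ => ?_
    rw [show Pi.single i (y i) = y i • (Pi.single i 1 : Fin d → ℤ) by
      rw [← Pi.single_smul, smul_eq_mul, mul_one], map_zsmul, smul_eq_mul, mul_comm]
  have h1 : (fun i => h (Pi.single i 1)) = 0 := by
    refine Matrix.eq_zero_of_vecMul_eq_zero hc ?_
    ext k
    exact (key (A.col (c k))).symm.trans (h0 k)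
  exact AddMonoidHom.ext fun y => by simp [key y, h1]

/-- A nonzero functional whose support on the columns is contained in that of `h`, where `h` is
of minimal support among the functionals conformal to `g`, is conformal to `h` up to sign:
otherwise a suitable combination of the two would have smaller support than `h`. -/
theorem conformal_or_conformal_neg {g h φ : (Fin d → ℤ) →+ ℤ} (hg : Conformal A h g)
    (hmin : ∀ k, k ≠ 0 → Conformal A k g →
      (Finset.univ.filter fun i => h (A.col i) ≠ 0).card ≤
        (Finset.univ.filter fun i => k (A.col i) ≠ 0).card)
    {i₀ : Fin n} (hφ : φ (A.col i₀) ≠ 0) (hsupp : ∀ i, h (A.col i) = 0 → φ (A.col i) = 0) :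
    Conformal A φ h ∨ Conformal A (-φ) h := by
  wlog hpos : 0 < φ (A.col i₀) * h (A.col i₀) generalizing φ
  · have := this (φ := -φ) (by simpa using hφ) (fun i hi => by simp [hsupp i hi]) (by
      have h1 : h (A.col i₀) ≠ 0 := fun h0 => hφ (hsupp _ h0)
      have := (mul_ne_zero hφ h1).lt_of_le (not_lt.1 hpos)
      simpa using this)
    rwa [neg_neg, or_comm] at this
  left
  have : Nonempty (Fin n) := ⟨i₀⟩
  -- the largest ratio, for which `ψ` below keeps the signs of `h`
  obtain ⟨i₁, hi₁⟩ := Finite.exists_max fun i => (φ (A.col i) : ℚ) / h (A.col i)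
  have hquot : ∀ i, (φ (A.col i) : ℚ) / h (A.col i) * (h (A.col i) : ℚ) ^ 2 =
      φ (A.col i) * h (A.col i) := fun i => by
    rcases eq_or_ne (h (A.col i) : ℚ) 0 with h0 | h0
    · simp [h0]
    · field_simp
  have hcross : ∀ i, φ (A.col i) * h (A.col i) * h (A.col i₁) ^ 2 ≤
      φ (A.col i₁) * h (A.col i₁) * h (A.col i) ^ 2 := fun i => by
    have h1 := mul_le_mul_of_nonneg_right (hi₁ i)
      (mul_nonneg (sq_nonneg (h (A.col i) : ℚ)) (sq_nonneg (h (A.col i₁) : ℚ)))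
    rw [← mul_assoc, hquot, mul_comm ((h (A.col i) : ℚ) ^ 2), ← mul_assoc, hquot] at h1
    exact_mod_cast h1
  have hh₀ : h (A.col i₀) ≠ 0 := fun h0 => by simp [h0] at hpos
  have hh₁ : h (A.col i₁) ≠ 0 := fun h0 => by
    have h1 := hcross i₀
    have h2 := hi₁ i₀
    rw [h0] at h2
    simp only [Int.cast_zero, div_zero] at h2
    have h3 := hquot i₀
    have h4 : (0 : ℚ) < φ (A.col i₀) * h (A.col i₀) := by exact_mod_cast hpos
    nlinarith [sq_nonneg (h (A.col i₀) : ℚ)]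
  have hpos₁ : 0 < φ (A.col i₁) * h (A.col i₁) := by
    have h1 := hcross i₀
    have h2 : 0 < φ (A.col i₀) * h (A.col i₀) * h (A.col i₁) ^ 2 := by positivity
    exact pos_of_mul_pos_left (h2.trans_le h1) (sq_nonneg _)
  -- the combination of `h` and `φ` that vanishes on the column `i₁`
  set ψ : (Fin d → ℤ) →+ ℤ :=
    (φ (A.col i₁) * h (A.col i₁)) • h - (h (A.col i₁) ^ 2) • φ with hψ
  have hψi : ∀ i, ψ (A.col i) =
      φ (A.col i₁) * h (A.col i₁) * h (A.col i) - h (A.col i₁) ^ 2 * φ (A.col i) := fun i => by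
    simp [hψ]
  have hψconf : Conformal A ψ h := fun i => by
    refine or_iff_not_imp_left.2 fun hne => ?_
    have hi : h (A.col i) ≠ 0 := fun h0 => hne (by rw [hψi, h0, hsupp i h0]; simp)
    have h1 : 0 ≤ ψ (A.col i) * h (A.col i) := by
      rw [hψi]
      nlinarith [hcross i]
    exact h1.lt_of_ne' (mul_ne_zero hne hi)
  have hψ0 : ψ = 0 := by
    by_contra hne
    refine (hmin ψ hne (hψconf.trans hg)).not_gt (Finset.card_lt_card ?_)
    rw [Finset.ssubset_iff_of_subset]
    · exact ⟨i₁, by simpa using hh₁, by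
        simp only [Finset.mem_filter, Finset.mem_univ, true_and, not_not, hψi]
        ring⟩
    · intro i
      simp only [Finset.mem_filter, Finset.mem_univ, true_and]
      intro hi h0
      rcases hψconf i with h1 | h1
      · exact hi h1
      · simp [h0] at h1
  intro i
  refine or_iff_not_imp_left.2 fun hne => ?_
  have hi : h (A.col i) ≠ 0 := fun h0 => hne (hsupp i h0)
  have h1 := hψi i
  rw [hψ0, AddMonoidHom.zero_apply] at h1
  have h2 : 0 < φ (A.col i) * h (A.col i) * h (A.col i₁) ^ 2 := by
    have : φ (A.col i) * h (A.col i) * h (A.col i₁) ^ 2 =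
        φ (A.col i₁) * h (A.col i₁) * h (A.col i) ^ 2 := by
      linear_combination h (A.col i) * h1
    rw [this]
    positivity
  exact pos_of_mul_pos_left h2 (sq_nonneg _)

/-- Every nonzero integral functional admits a nonzero conformal functional with values in
`{-1, 0, 1}` on the columns. One of minimal support is, up to a positive factor and a sign, given
by Cramer's rule for a suitable basis of columns. -/
theorem exists_conformal_unit (hA : IsUnimodularMatrix A) {g : (Fin d → ℤ) →+ ℤ} (hg : g ≠ 0) :
    ∃ h : (Fin d → ℤ) →+ ℤ, h ≠ 0 ∧ Conformal A h g ∧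
      ∀ i, h (A.col i) = 0 ∨ h (A.col i) = 1 ∨ h (A.col i) = -1 := by
  obtain ⟨h, ⟨hh0, hhg⟩, hmin⟩ := exists_minimalFor_of_wellFoundedLT
    (fun h : (Fin d → ℤ) →+ ℤ => h ≠ 0 ∧ Conformal A h g)
    (fun h => (Finset.univ.filter fun i => h (A.col i) ≠ 0).card) ⟨g, hg, Conformal.refl g⟩
  have hmin' : ∀ k, k ≠ 0 → Conformal A k g →
      (Finset.univ.filter fun i => h (A.col i) ≠ 0).card ≤
        (Finset.univ.filter fun i => k (A.col i) ≠ 0).card := fun k hk hkg =>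
    (le_total _ _).elim id fun hle => hmin ⟨hk, hkg⟩ hle
  -- a basis of columns with as few columns outside the kernel of `h` as possible
  obtain ⟨c, hc, hcmin⟩ := exists_minimalFor_of_wellFoundedLT
    (fun c : Fin d → Fin n => (A.submatrix id c).det ≠ 0)
    (fun c => (Finset.univ.filter fun k => h (A.col (c k)) ≠ 0).card)
    (exists_det_submatrix_ne_zero hA)
  obtain ⟨k, hk⟩ : ∃ k, h (A.col (c k)) ≠ 0 := by
    by_contra! hall
    exact hh0 (eq_zero_of_forall_col hc hall)
  set φ := cramerFunctional (A.submatrix id c) k with hφ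
  have hφk : φ (A.col (c k)) ≠ 0 := by
    rwa [hφ, cramerFunctional_col, Function.update_eq_self]
  have hsupp : ∀ i, h (A.col i) = 0 → φ (A.col i) = 0 := fun i hi => by
    by_contra hne
    rw [hφ, cramerFunctional_col] at hne
    have hlt : (Finset.univ.filter fun l => h (A.col (Function.update c k i l)) ≠ 0).card <
        (Finset.univ.filter fun l => h (A.col (c l)) ≠ 0).card := by
      refine Finset.card_lt_card ((Finset.ssubset_iff_of_subset fun l => ?_).2
        ⟨k, by simpa using hk, by simpa using hi⟩)
      rcases eq_or_ne l k with rfl | hl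
      · simp [hi]
      · simp [hl]
    exact hlt.not_ge (hcmin hne hlt.le)
  have hval : ∀ i, φ (A.col i) = 0 ∨ φ (A.col i) = 1 ∨ φ (A.col i) = -1 := fun i => by
    rw [hφ, cramerFunctional_col]
    exact det_submatrix_mem hA _
  have hφ0 : φ ≠ 0 := fun h0 => hφk (by rw [h0]; rfl)
  rcases conformal_or_conformal_neg hhg hmin' hφk hsupp with hcon | hcon
  · exact ⟨φ, hφ0, hcon.trans hhg, hval⟩
  · refine ⟨-φ, neg_ne_zero.2 hφ0, hcon.trans hhg, fun i => ?_⟩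
    rcases hval i with h1 | h1 | h1 <;> simp [h1]

/-- The nonzero integral functionals with values in `{-1, 0, 1}` on the columns of `A` that vanish
on the columns in `T`. They include the facet normals of the zonotope of the contraction by `T`. -/
def unitFunctionals (A : Matrix (Fin d) (Fin n) ℤ) (T : Set (Fin n)) :
    Set ((Fin d → ℤ) →+ ℤ) :=
  {h | h ≠ 0 ∧ (∀ i, h (A.col i) = 0 ∨ h (A.col i) = 1 ∨ h (A.col i) = -1) ∧
    ∀ i ∈ T, h (A.col i) = 0}

theorem neg_mem_unitFunctionals {T : Set (Fin n)} {h : (Fin d → ℤ) →+ ℤ}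
    (hh : h ∈ unitFunctionals A T) : -h ∈ unitFunctionals A T := by
  refine ⟨neg_ne_zero.2 hh.1, fun i => ?_, fun i hi => by simp [hh.2.2 i hi]⟩
  rcases hh.2.1 i with h1 | h1 | h1 <;> simp [h1]

section Bound

variable {R : Type*} [CommRing R] [LinearOrder R] [IsStrictOrderedRing R]

/-- The maximum of the functional `h` on the zonotope `{∑ tᵢ aᵢ | 0 ≤ tᵢ ≤ wᵢ}`, where
the weights `w` are nonnegative. -/
def supportBound (A : Matrix (Fin d) (Fin n) ℤ) (w : Fin n → R) (h : (Fin d → ℤ) →+ ℤ) : R :=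
  ∑ i, w i * ((max (h (A.col i)) 0 : ℤ) : R)

theorem supportBound_nonneg {w : Fin n → R} (hw : ∀ i, 0 ≤ w i) (h : (Fin d → ℤ) →+ ℤ) :
    0 ≤ supportBound A w h :=
  Finset.sum_nonneg fun i _ => mul_nonneg (hw i) (by exact_mod_cast le_max_right _ _)

/-- If `h + h'` vanishes on the column `v`, on which `h` and `h'` take the values `1` and `-1`, the
subadditivity of the support function improves by the weight of `v`. -/
theorem supportBound_add_add_le {w : Fin n → R} (hw : ∀ i, 0 ≤ w i) {h h' : (Fin d → ℤ) →+ ℤ}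
    {v : Fin n} (hv : h (A.col v) = 1) (hv' : h' (A.col v) = -1) :
    supportBound A w (h + h') + w v ≤ supportBound A w h + supportBound A w h' := by
  have h1 : w v = ∑ i, w i * (if i = v then 1 else 0) := by simp
  rw [supportBound, h1, supportBound, supportBound, ← Finset.sum_add_distrib,
    ← Finset.sum_add_distrib]
  refine Finset.sum_le_sum fun i _ => ?_
  rw [← mul_add, ← mul_add]
  refine mul_le_mul_of_nonneg_left ?_ (hw i)
  have : (max ((h + h') (A.col i)) 0 + if i = v then 1 else 0 : ℤ) ≤
      max (h (A.col i)) 0 + max (h' (A.col i)) 0 := by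
    rw [AddMonoidHom.add_apply]
    split_ifs with hi
    · rw [hi, hv, hv']
      norm_num
    · omega
  calc _ = ((max ((h + h') (A.col i)) 0 + if i = v then 1 else 0 : ℤ) : R) := by push_cast; rfl
    _ ≤ ((max (h (A.col i)) 0 + max (h' (A.col i)) 0 : ℤ) : R) := by exact_mod_cast this
    _ = _ := by push_cast; rfl

/-- Inequalities for the `{-1, 0, 1}`-valued functionals imply the corresponding inequalities for
all integral functionals, by decomposing these conformally. -/
theorem le_supportBound_of_unit (hA : IsUnimodularMatrix A) {T : Set (Fin n)} {w : Fin n → R}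
    {ε : R} (hε : 0 ≤ ε) {L : ((Fin d → ℤ) →+ ℤ) →+ R}
    (hL : ∀ h ∈ unitFunctionals A T, L h ≤ supportBound A w h - ε) {g : (Fin d → ℤ) →+ ℤ}
    (hg : g ≠ 0) (hgT : ∀ i ∈ T, g (A.col i) = 0) : L g ≤ supportBound A w g - ε := by
  induction hN : (∑ i, (g (A.col i)).natAbs) using Nat.strong_induction_on generalizing g with
  | _ N ih =>
  obtain ⟨h, hh0, hconf, hval⟩ := exists_conformal_unit hA hg
  have hcase : ∀ i, (h (A.col i) = 0) ∨ (h (A.col i) = 1 ∧ 1 ≤ g (A.col i)) ∨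
      (h (A.col i) = -1 ∧ g (A.col i) ≤ -1) := fun i => by
    rcases hconf i with h1 | h1
    · exact Or.inl h1
    · rcases hval i with h2 | h2 | h2 <;> rw [h2] at h1 ⊢ <;> omega
  have hh : h ∈ unitFunctionals A T := ⟨hh0, hval, fun i hi => by
    rcases hcase i with h1 | h1 | h1
    · exact h1
    · have := hgT i hi
      omega
    · have := hgT i hi
      omega⟩
  rcases eq_or_ne (g - h) 0 with hgh | hgh
  · rw [sub_eq_zero.1 hgh]
    exact hL h hh
  · have hsum : supportBound A w g = supportBound A w h + supportBound A w (g - h) := by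
      rw [supportBound, supportBound, supportBound, ← Finset.sum_add_distrib]
      refine Finset.sum_congr rfl fun i _ => ?_
      rw [← mul_add, ← Int.cast_add]
      congr 2
      rw [AddMonoidHom.sub_apply]
      rcases hcase i with h1 | h1 | h1 <;> omega
    have hlt : ∑ i, ((g - h) (A.col i)).natAbs < N := by
      rw [← hN]
      obtain ⟨c, hc⟩ := exists_det_submatrix_ne_zero hA
      obtain ⟨k, hk⟩ : ∃ k, h (A.col (c k)) ≠ 0 := by
        by_contra! hall
        exact hh0 (eq_zero_of_forall_col hc hall)
      refine Finset.sum_lt_sum (fun i _ => ?_) ⟨c k, Finset.mem_univ _, ?_⟩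
      · rw [AddMonoidHom.sub_apply]
        rcases hcase i with h1 | h1 | h1 <;> omega
      · rw [AddMonoidHom.sub_apply]
        rcases hcase (c k) with h1 | h1 | h1 <;> omega
    have h1 := hL h hh
    have h2 := ih _ hlt hgh (fun i hi => by
      rw [AddMonoidHom.sub_apply, hgT i hi, hh.2.2 i hi, sub_zero]) rfl
    rw [map_sub] at h2
    linarith

end Bound

end Conformal

/-! ### Polynomial functions on `ℤᵈ` are polynomials -/

section Polynomial

variable {d : ℕ}

/-- Evaluation of polynomials at the integral points. -/
noncomputable def evalInt (d : ℕ) : MvPolynomial (Fin d) ℂ →ₗ[ℂ] ((Fin d → ℤ) → ℂ) where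
  toFun p z := MvPolynomial.eval (fun i => (z i : ℂ)) p
  map_add' p q := by
    ext z
    simp
  map_smul' c p := by
    ext z
    simp [MvPolynomial.smul_eval]

theorem evalInt_apply (p : MvPolynomial (Fin d) ℂ) (z : Fin d → ℤ) :
    evalInt d p z = MvPolynomial.eval (fun i => (z i : ℂ)) p := rfl

theorem evalInt_mul (p q : MvPolynomial (Fin d) ℂ) :
    evalInt d (p * q) = evalInt d p * evalInt d q := by
  ext z
  simp [evalInt_apply]

/-- The polynomials of degree less than `k`. -/
noncomputable def polyLT (d k : ℕ) : Submodule ℂ (MvPolynomial (Fin d) ℂ) :=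
  MvPolynomial.restrictSupport ℂ {m | m.degree < k}

theorem polyFun_mono {V : Type*} [AddCommGroup V] : Monotone (polyFun V) :=
  monotone_nat_of_le_succ polyFun_le_succ

theorem evalInt_monomial_mem (m : Fin d →₀ ℕ) :
    evalInt d (MvPolynomial.monomial m 1) ∈ polyFun (Fin d → ℤ) (m.degree + 1) := by
  have hadd : ∀ m₁ m₂ : Fin d →₀ ℕ,
      evalInt d (MvPolynomial.monomial m₁ 1) ∈ polyFun (Fin d → ℤ) (m₁.degree + 1) →
      evalInt d (MvPolynomial.monomial m₂ 1) ∈ polyFun (Fin d → ℤ) (m₂.degree + 1) →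
      evalInt d (MvPolynomial.monomial (m₁ + m₂) 1) ∈
        polyFun (Fin d → ℤ) ((m₁ + m₂).degree + 1) := fun m₁ m₂ h₁ h₂ => by
    rw [← one_mul (1 : ℂ), ← MvPolynomial.monomial_mul, evalInt_mul, map_add]
    exact mul_mem_polyFun h₁ h₂
  have hzero : evalInt d (MvPolynomial.monomial 0 1) ∈
      polyFun (Fin d → ℤ) ((0 : Fin d →₀ ℕ).degree + 1) := by
    have : evalInt d (MvPolynomial.monomial 0 1) = fun _ => 1 := by
      ext z
      simp [evalInt_apply]
    rw [this]
    exact const_mem_polyFun _ _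
  induction m using Finsupp.induction_linear with
  | zero => exact hzero
  | add f g hf hg => exact hadd f g hf hg
  | single i k =>
    induction k with
    | zero => simpa using hzero
    | succ k ih =>
      rw [Finsupp.single_add]
      refine hadd _ _ ih ?_
      rw [Finsupp.degree_single, mem_polyFun_succ]
      intro w
      have : diffMap w (evalInt d (MvPolynomial.monomial (Finsupp.single i 1) 1)) =
          fun _ => (w i : ℂ) := by
        ext z
        simp [diffMap_apply, evalInt_apply, MvPolynomial.eval_monomial]
      rw [this]
      exact const_mem_polyFun _ _

theorem map_polyLT_le (d k : ℕ) : (polyLT d k).map (evalInt d) ≤ polyFun (Fin d → ℤ) k := by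
  rw [polyLT, MvPolynomial.restrictSupport_eq_span, Submodule.map_span, Submodule.span_le]
  rintro _ ⟨_, ⟨m, hm, rfl⟩, rfl⟩
  exact polyFun_mono (Nat.succ_le_of_lt hm) (evalInt_monomial_mem m)

theorem evalInt_injective (d : ℕ) : Function.Injective (evalInt d) := by
  intro p q hpq
  refine MvPolynomial.funext_set (fun _ : Fin d => Set.range (Int.cast : ℤ → ℂ))
    (fun _ => Set.infinite_range_of_injective Int.cast_injective) fun x hx => ?_
  choose z hz using fun i => hx i (Set.mem_univ i)
  obtain rfl : (fun i => (z i : ℂ)) = x := funext hz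
  exact congrFun hpq z

/-- A polynomial function of degree less than `k` is determined by its values at the points with
natural coordinates of sum less than `k`. -/
theorem eq_zero_of_mem_polyFun {k : ℕ} {g : (Fin d → ℤ) → ℂ} (hg : g ∈ polyFun (Fin d → ℤ) k)
    (h0 : ∀ m : Fin d →₀ ℕ, m.degree < k → g (fun i => (m i : ℤ)) = 0) : g = 0 := by
  induction k generalizing g with
  | zero => exact hg
  | succ k ih =>
    have hinv : ∀ (i : Fin d) (x : Fin d → ℤ), g (x + Pi.single i 1) = g x := fun i x => by
      have h1 : diffMap (Pi.single i 1) g = 0 := ih (mem_polyFun_succ.1 hg _) fun m hm => by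
        rw [diffMap_apply, h0 m (by omega), sub_zero]
        have h2 := h0 (m + Finsupp.single i 1) (by
          rw [map_add, Finsupp.degree_single]
          omega)
        rw [← h2]
        congr 1
        ext j
        rcases eq_or_ne i j with rfl | hij <;> simp_all [Finsupp.single_apply]
      have := congrFun h1 x
      rwa [diffMap_apply, Pi.zero_apply, sub_eq_zero] at this
    have hconst : ∀ (x : Fin d → ℤ) (s : Finset (Fin d)),
        g (∑ i ∈ s, Pi.single i (x i)) = g 0 := fun x s => by
      induction s using Finset.induction_on with
      | empty => simp
      | insert i s hi ihs =>
        rw [Finset.sum_insert hi, add_comm, ← ihs,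
          show Pi.single i (x i) = x i • (Pi.single i 1 : Fin d → ℤ) by
            rw [← Pi.single_smul, smul_eq_mul, mul_one]]
        exact invariant_zsmul (hinv i) _ _
    ext x
    rw [← Finset.univ_sum_single x, hconst]
    exact h0 0 (by simp)

theorem polyFun_finite_and_finrank_le (d k : ℕ) :
    FiniteDimensional ℂ (polyFun (Fin d → ℤ) k) ∧
      Module.finrank ℂ (polyFun (Fin d → ℤ) k) ≤ Nat.card {m : Fin d →₀ ℕ | m.degree < k} := by
  have := (Finsupp.finite_of_degree_lt (σ := Fin d) k).fintype
  let φ : polyFun (Fin d → ℤ) k →ₗ[ℂ] ({m : Fin d →₀ ℕ | m.degree < k} → ℂ) :=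
    (LinearMap.funLeft ℂ ℂ fun m i => (m.1 i : ℤ)).comp (polyFun (Fin d → ℤ) k).subtype
  have hφ : Function.Injective φ := by
    rw [injective_iff_map_eq_zero]
    intro g hg
    exact Subtype.ext (eq_zero_of_mem_polyFun g.2 fun m hm => congrFun hg ⟨m, hm⟩)
  refine ⟨FiniteDimensional.of_injective φ hφ,
    (LinearMap.finrank_le_finrank_of_injective hφ).trans ?_⟩
  rw [Module.finrank_fintype_fun_eq_card, Nat.card_eq_fintype_card]

instance polyFun_finiteDimensional (d k : ℕ) : FiniteDimensional ℂ (polyFun (Fin d → ℤ) k) :=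
  (polyFun_finite_and_finrank_le d k).1

/-- The functions on `ℤᵈ` killed by all products of `k` differences are the polynomials of degree
less than `k`, by comparison of dimensions. -/
theorem map_polyLT (d k : ℕ) : (polyLT d k).map (evalInt d) = polyFun (Fin d → ℤ) k := by
  refine Submodule.eq_of_le_of_finrank_le (map_polyLT_le d k) ?_
  rw [← (Submodule.equivMapOfInjective _ (evalInt_injective d) (polyLT d k)).finrank_eq, polyLT,
    Module.finrank_eq_nat_card_basis (MvPolynomial.basisRestrictSupport ℂ _)]
  exact (polyFun_finite_and_finrank_le d k).2

end Polynomial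

/-! ### Graded counts for unimodular zonotopes and their contractions -/

section Zonotope

variable {d n : ℕ} {A : Matrix (Fin d) (Fin n) ℤ}

/-- The bound on `h` over the lattice points of the zonotope in which the column `i` is repeated
`μ i` times, for the closed zonotope (`ε = 0`) and its interior (`ε = 1`). -/
def zonotopeBound (A : Matrix (Fin d) (Fin n) ℤ) (μ : Fin n → ℕ) (ε : ℤ)
    (h : (Fin d → ℤ) →+ ℤ) : ℤ := supportBound A (fun i => (μ i : ℤ)) h - ε

theorem zonotopeBound_add_neg (μ : Fin n → ℕ) (ε : ℤ) (h : (Fin d → ℤ) →+ ℤ) :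
    zonotopeBound A μ ε h + zonotopeBound A μ ε (-h) = ∑ i, μ i * |h (A.col i)| - 2 * ε := by
  have : ∑ i, (μ i : ℤ) * |h (A.col i)| =
      supportBound A (fun i => (μ i : ℤ)) h + supportBound A (fun i => (μ i : ℤ)) (-h) := by
    rw [supportBound, supportBound, ← Finset.sum_add_distrib]
    refine Finset.sum_congr rfl fun i _ => ?_
    rw [← mul_add, Int.cast_id, Int.cast_id, AddMonoidHom.neg_apply]
    congr 1
    rcases abs_cases (h (A.col i)) with h1 | h1 <;> omega
  rw [this, zonotopeBound, zonotopeBound]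
  ring

theorem contract_unitFunctionals (T : Set (Fin n)) (v : Fin n) :
    contract (unitFunctionals A T) (A.col v) = unitFunctionals A (insert v T) := by
  ext h
  simp only [contract, unitFunctionals, Set.mem_ofPred_eq, Set.forall_mem_insert]
  tauto

theorem sum_add_single_mul (μ : Fin n → ℕ) (v : Fin n) (c : Fin n → ℤ) :
    ∑ i, (((μ + Pi.single v 1 : Fin n → ℕ) i : ℕ) : ℤ) * c i = ∑ i, μ i * c i + c v := by
  simp [Pi.single_apply, add_mul, Finset.sum_add_distrib]

theorem lower_zonotopeBound (μ : Fin n → ℕ) (ε : ℤ) {T : Set (Fin n)} {h : (Fin d → ℤ) →+ ℤ}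
    (hh : h ∈ unitFunctionals A T) (v : Fin n) :
    lower (zonotopeBound A (μ + Pi.single v 1) ε) (A.col v) h = zonotopeBound A μ ε h := by
  have : supportBound A (fun i => (((μ + Pi.single v 1 : Fin n → ℕ) i : ℕ) : ℤ)) h =
      supportBound A (fun i => (μ i : ℤ)) h + max (h (A.col v)) 0 :=
    sum_add_single_mul μ v fun i => max (h (A.col i)) 0
  rw [lower, zonotopeBound, zonotopeBound, this]
  rcases hh.2.1 v with h1 | h1 | h1
  · simp [h1]
  · rw [h1]
    norm_num
    ring
  · simp [h1]

theorem region_congr {V : Type*} [AddCommGroup V] {H : Set (V →+ ℤ)} {b b' : (V →+ ℤ) → ℤ}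
    (h : ∀ g ∈ H, b g = b' g) : region H b = region H b' := by
  ext y
  exact forall₂_congr fun g hg => by rw [h g hg]

theorem regionDim_congr {V : Type*} [AddCommGroup V] {H H' : Set (V →+ ℤ)}
    {b b' : (V →+ ℤ) → ℤ} (C : Set V) (h : region H b = region H' b') (k : ℕ) :
    regionDim H b C k = regionDim H' b' C k := by
  rw [regionDim, regionDim, h]

theorem SlabGenerated.congr {V : Type*} [AddCommGroup V] {H : Set (V →+ ℤ)}
    {b b' : (V →+ ℤ) → ℤ} {C : Set V} (hneg : ∀ g ∈ H, -g ∈ H) (h : ∀ g ∈ H, b g = b' g)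
    (hb : SlabGenerated H b C) : SlabGenerated H b' C := by
  intro k
  rw [← region_congr h]
  refine (hb k).trans (iSup₂_mono fun g hg => ?_)
  rw [slab, slab, h g hg, h _ (hneg g hg)]

/-- A column outside the span of the contracted ones is an admissible direction, provided that the
slabs are nonempty. That contraction is surjective on lattice points follows from Helly's theorem
on the line and the conformal decomposition of differences of unit functionals. -/
theorem isAdmissible_zonotope (hA : IsUnimodularMatrix A) {μ : Fin n → ℕ} {ε : ℤ} (hε : 0 ≤ ε)
    {T : Set (Fin n)} {v : Fin n} (hv : ε ≤ μ v)
    (hloop : ∃ h ∈ unitFunctionals A T, h (A.col v) ≠ 0)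
    (hne : ∀ h ∈ unitFunctionals A T, h (A.col v) ≠ 0 →
      0 ≤ zonotopeBound A μ ε h + zonotopeBound A μ ε (-h)) :
    IsAdmissible (unitFunctionals A T) (zonotopeBound A μ ε) (A.col '' T) (A.col v) := by
  have hone : ∃ h ∈ unitFunctionals A T, h (A.col v) = 1 := by
    obtain ⟨h, hh, h0⟩ := hloop
    rcases hh.2.1 v with h1 | h1 | h1
    · exact absurd h1 h0
    · exact ⟨h, hh, h1⟩
    · exact ⟨-h, neg_mem_unitFunctionals hh, by simp [h1]⟩
  refine ⟨fun h => neg_mem_unitFunctionals, ?_, fun h hh => hh.2.1 v, hone, fun y hy => ?_⟩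
  · rintro h hh _ ⟨i, hi, rfl⟩
    exact hh.2.2 i hi
  rw [contract_unitFunctionals] at hy
  have hpair : ∀ h ∈ unitFunctionals A T, ∀ h' ∈ unitFunctionals A T, h (A.col v) = 1 →
      h' (A.col v) = -1 → h y + h' y ≤ zonotopeBound A μ ε h + zonotopeBound A μ ε h' := by
    intro h hh h' hh' hv1 hv1'
    rcases eq_or_ne (h + h') 0 with h0 | h0
    · obtain rfl : h' = -h := (neg_eq_of_add_eq_zero_right h0).symm
      have := hne h hh (by omega)
      rw [AddMonoidHom.neg_apply]
      omega
    · have h1 := le_supportBound_of_unit hA hε (T := insert v T) (w := fun i => (μ i : ℤ))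
        (L := AddMonoidHom.eval y) hy h0 (by
          rintro i (rfl | hi)
          · simp [hv1, hv1']
          · simp [hh.2.2 i hi, hh'.2.2 i hi])
      have h2 := supportBound_add_add_le (w := fun i => (μ i : ℤ)) (fun i => by positivity) hv1 hv1'
      have h3 : h y + h' y ≤ supportBound A (fun i => (μ i : ℤ)) (h + h') - ε := h1
      rw [zonotopeBound, zonotopeBound]
      omega
  obtain ⟨h₀, hh₀, hv₀⟩ := hone
  -- the smallest multiple of `v` whose addition restores the inequalities of the functionals with
  -- value `-1` on `v`; those with value `1` then hold by `hpair`
  obtain ⟨k, ⟨h', hh', hv', hk⟩, hmax⟩ := Int.exists_greatest_of_bdd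
    (P := fun k => ∃ h' ∈ unitFunctionals A T, h' (A.col v) = -1 ∧
      k = h' y - zonotopeBound A μ ε h')
    ⟨zonotopeBound A μ ε h₀ - h₀ y, by
      rintro _ ⟨h', hh', hv', rfl⟩
      have := hpair h₀ hh₀ h' hh' hv₀ hv'
      omega⟩
    ⟨_, -h₀, neg_mem_unitFunctionals hh₀, by simp [hv₀], rfl⟩
  refine ⟨k, fun h hh => ?_⟩
  rw [map_add, map_zsmul, smul_eq_mul]
  rcases hh.2.1 v with h1 | h1 | h1
  · rw [h1, mul_zero, add_zero]
    refine hy h ⟨hh.1, hh.2.1, ?_⟩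
    rintro i (rfl | hi)
    · exact h1
    · exact hh.2.2 i hi
  · have := hpair h hh h' hh' h1 hv'
    rw [h1]
    omega
  · have := hmax _ ⟨h, hh, h1, rfl⟩
    rw [h1]
    omega

theorem exists_single_add {μ : Fin n → ℕ} {v : Fin n} (hv : 0 < μ v) :
    ∃ μ' : Fin n → ℕ, μ = μ' + Pi.single v 1 := by
  refine ⟨μ - Pi.single v 1, (tsub_add_cancel_of_le ?_).symm⟩
  intro i
  rcases eq_or_ne i v with rfl | hi
  · simpa using Nat.succ_le_of_lt hv
  · simp [hi]

/-- The polynomial functions vanishing on the lattice points of a contracted unimodular zonotope,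
or on those of its interior, are generated by the ones vanishing on slabs. -/
theorem slabGenerated_zonotope (hA : IsUnimodularMatrix A) {ε : ℤ} (hε : ε = 0 ∨ ε = 1)
    (μ : Fin n → ℕ) (T : Set (Fin n)) :
    SlabGenerated (unitFunctionals A T) (zonotopeBound A μ ε) (A.col '' T) := by
  induction hN : Tᶜ.ncard using Nat.strong_induction_on generalizing T μ with
  | _ N ihT =>
  induction hM : ∑ i, μ i using Nat.strong_induction_on generalizing μ with
  | _ M ihμ =>
  by_cases hneg : ∃ h ∈ unitFunctionals A T,
      zonotopeBound A μ ε h + zonotopeBound A μ ε (-h) < 0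
  · obtain ⟨h, hh, h0⟩ := hneg
    exact SlabGenerated.of_slab_eq_empty hh h0
  push Not at hneg
  have hcon : ∀ v, (∃ h ∈ unitFunctionals A T, h (A.col v) ≠ 0) →
      SlabGenerated (contract (unitFunctionals A T) (A.col v)) (zonotopeBound A μ ε)
        (insert (A.col v) (A.col '' T)) := by
    rintro v ⟨h, hh, h0⟩
    have hvT : v ∉ T := fun hv => h0 (hh.2.2 v hv)
    rw [contract_unitFunctionals, ← Set.image_insert_eq]
    refine ihT _ ?_ μ (insert v T) rfl
    rw [← hN]
    refine Set.ncard_lt_ncard ?_ (Set.toFinite _)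
    exact ⟨Set.compl_subset_compl.2 (Set.subset_insert v T), fun hsub =>
      hsub hvT (Set.mem_insert v T)⟩
  by_cases hex : ∃ v, 0 < μ v ∧ ∃ h ∈ unitFunctionals A T, h (A.col v) ≠ 0
  · obtain ⟨v, hv, hloop⟩ := hex
    refine SlabGenerated.of_lower_of_contract
      (isAdmissible_zonotope hA (by omega) (by omega) hloop fun h hh _ => hneg h hh) ?_
      (hcon v hloop)
    obtain ⟨μ', rfl⟩ := exists_single_add hv
    refine (ihμ _ ?_ μ' rfl).congr (fun _ => neg_mem_unitFunctionals)
      fun h hh => (lower_zonotopeBound μ' ε hh v).symm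
    rw [← hM]
    simp [Finset.sum_add_distrib]
  · push Not at hex
    -- all slabs have width `-2 * ε` here, so the deleted slabs are empty
    have hwidth : ∀ h ∈ unitFunctionals A T,
        zonotopeBound A μ ε h + zonotopeBound A μ ε (-h) = -2 * ε := fun h hh => by
      rw [zonotopeBound_add_neg, Finset.sum_eq_zero, zero_sub, neg_mul]
      intro i _
      rcases Nat.eq_zero_or_pos (μ i) with h0 | h0
      · simp [h0]
      · simp [hex i h0 h hh]
    by_cases hloop : ∃ v, ∃ h ∈ unitFunctionals A T, h (A.col v) ≠ 0
    · obtain ⟨v, h, hh, h0⟩ := hloop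
      have h1 := hneg h hh
      rw [hwidth h hh] at h1
      obtain rfl : ε = 0 := by omega
      refine SlabGenerated.of_lower_of_contract (isAdmissible_zonotope hA le_rfl (by positivity)
        ⟨h, hh, h0⟩ fun h hh _ => hneg h hh) ?_ (hcon v ⟨h, hh, h0⟩)
      refine SlabGenerated.of_slab_eq_empty hh ?_
      have h2 := hwidth h hh
      rw [lower, lower, AddMonoidHom.neg_apply]
      rcases hh.2.1 v with h3 | h3 | h3
      · exact absurd h3 h0
      · rw [h3]
        norm_num
        omega
      · rw [h3]
        norm_num
        omega
    · push Not at hloop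
      rintro k f ⟨-, hf⟩
      have : f = 0 := by
        ext y
        refine hf y fun h hh => absurd ?_ hh.1
        obtain ⟨c, hc⟩ := exists_det_submatrix_ne_zero hA
        exact eq_zero_of_forall_col hc fun k => hloop (c k) h hh
      rw [this]
      exact zero_mem _

/-- The Hilbert series `∑ⱼ (rⱼ₊₁ - rⱼ) qʲ` of a filtered space whose steps have dimensions `rⱼ`. -/
noncomputable def dimSeries (r : ℕ → ℕ) : PowerSeries ℤ :=
  PowerSeries.mk fun j => (r (j + 1) : ℤ) - r j

theorem dimSeries_eq {r r₁ r₂ : ℕ → ℕ} (h0 : r 0 = 0) (h₁ : r₁ 0 = 0) (h₂ : r₂ 0 = 0)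
    (h : ∀ k, r (k + 1) = r₁ k + r₂ (k + 1)) :
    dimSeries r = PowerSeries.X * dimSeries r₁ + dimSeries r₂ := by
  ext j
  cases j with
  | zero => simp [dimSeries, h, h0, h₁, h₂]
  | succ j =>
    rw [map_add, PowerSeries.coeff_succ_X_mul]
    simp only [dimSeries, PowerSeries.coeff_mk, h]
    push_cast
    ring

/-- The graded count of the lattice points of the zonotope with multiplicities `μ`, contracted by
the columns in `T`; of the interior for `ε = 1`. -/
noncomputable def zonotopeSeries (A : Matrix (Fin d) (Fin n) ℤ) (μ : Fin n → ℕ) (ε : ℤ)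
    (T : Set (Fin n)) : PowerSeries ℤ :=
  dimSeries (regionDim (unitFunctionals A T) (zonotopeBound A μ ε) (A.col '' T))

/-- The column `v` lies in the span of the columns in `T`. In the unimodular case this can be tested
on the functionals with values in `{-1, 0, 1}`. -/
def IsLoop (A : Matrix (Fin d) (Fin n) ℤ) (T : Set (Fin n)) (v : Fin n) : Prop :=
  ∀ h ∈ unitFunctionals A T, h (A.col v) = 0

theorem regionDim_contract_zonotope (μ μ' : Fin n → ℕ) (ε : ℤ) (T : Set (Fin n)) (v : Fin n)
    (hμ : ∀ i, i ≠ v → μ i = μ' i) :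
    regionDim (contract (unitFunctionals A T) (A.col v)) (zonotopeBound A μ ε)
      (insert (A.col v) (A.col '' T)) =
    regionDim (unitFunctionals A (insert v T)) (zonotopeBound A μ' ε) (A.col '' insert v T) := by
  rw [contract_unitFunctionals, ← Set.image_insert_eq]
  funext k
  refine regionDim_congr _ (region_congr fun h hh => ?_) k
  rw [zonotopeBound, zonotopeBound, supportBound, supportBound]
  congr 1
  refine Finset.sum_congr rfl fun i _ => ?_
  rcases eq_or_ne i v with rfl | hi
  · simp [hh.2.2 i (Set.mem_insert i T)]
  · rw [hμ i hi]

/-- Multiplicities of columns in the span of the contracted ones do not matter. -/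
theorem zonotopeSeries_congr {μ μ' : Fin n → ℕ} (ε : ℤ) {T : Set (Fin n)}
    (hμ : ∀ i, ¬IsLoop A T i → μ i = μ' i) : zonotopeSeries A μ ε T = zonotopeSeries A μ' ε T := by
  rw [zonotopeSeries, zonotopeSeries]
  congr 1
  funext k
  refine regionDim_congr _ (region_congr fun h hh => ?_) k
  rw [zonotopeBound, zonotopeBound, supportBound, supportBound]
  congr 1
  refine Finset.sum_congr rfl fun i _ => ?_
  by_cases hi : IsLoop A T i
  · simp [hi h hh]
  · rw [hμ i hi]

/-- Deletion and contraction of one copy of the column `v`. -/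
theorem zonotopeSeries_add_single (hA : IsUnimodularMatrix A) {ε : ℤ} (hε : ε = 0 ∨ ε = 1)
    (μ : Fin n → ℕ) {T : Set (Fin n)} {v : Fin n} (hloop : ¬IsLoop A T v)
    (hwidth : ∀ h ∈ unitFunctionals A T, h (A.col v) ≠ 0 →
      2 * ε ≤ ∑ i, μ i * |h (A.col i)| + 1) :
    zonotopeSeries A (μ + Pi.single v 1) ε T =
      PowerSeries.X * zonotopeSeries A μ ε T + zonotopeSeries A μ ε (insert v T) := by
  have hadm := isAdmissible_zonotope hA (μ := μ + Pi.single v 1) (ε := ε) (T := T) (v := v)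
    (by omega) (by simp; omega) (by simpa [IsLoop] using hloop) fun h hh h0 => by
      rw [zonotopeBound_add_neg, sum_add_single_mul μ v fun i => |h (A.col i)|]
      have h2 := hwidth h hh h0
      have h3 := Int.one_le_abs h0
      omega
  have hlow : ∀ h ∈ unitFunctionals A T, zonotopeBound A μ ε h =
      lower (zonotopeBound A (μ + Pi.single v 1) ε) (A.col v) h :=
    fun h hh => (lower_zonotopeBound μ ε hh v).symm
  refine dimSeries_eq (regionDim_zero ..) (regionDim_zero ..) (regionDim_zero ..) fun k => ?_
  rw [regionDim_succ hadm ((slabGenerated_zonotope hA hε μ T).congr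
      (fun _ => neg_mem_unitFunctionals) hlow), regionDim_contract_zonotope _ μ _ _ _
      fun i hi => by simp [hi], regionDim_congr _ (region_congr hlow)]

/-- A column with multiplicity zero that is independent of the other columns occurring can be
contracted without changing the count of the closed zonotope. -/
theorem zonotopeSeries_insert_of_coloop (hA : IsUnimodularMatrix A) (μ : Fin n → ℕ)
    {T : Set (Fin n)} {v : Fin n}
    (hcoloop : ∃ h ∈ unitFunctionals A T, h (A.col v) ≠ 0 ∧ ∑ i, μ i * |h (A.col i)| = 0) :
    zonotopeSeries A μ 0 T = zonotopeSeries A μ 0 (insert v T) := by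
  obtain ⟨h, hh, h0, hsum⟩ := hcoloop
  have hadm := isAdmissible_zonotope hA (μ := μ) (ε := 0) (T := T) (v := v)
    le_rfl (by positivity) ⟨h, hh, h0⟩ fun h hh h0 => by
      rw [zonotopeBound_add_neg, mul_zero, sub_zero]
      positivity
  have hempty : lower (zonotopeBound A μ 0) (A.col v) h +
      lower (zonotopeBound A μ 0) (A.col v) (-h) < 0 := by
    have h2 := zonotopeBound_add_neg (A := A) μ 0 h
    rw [hsum] at h2
    rw [lower, lower, AddMonoidHom.neg_apply]
    rcases hh.2.1 v with h3 | h3 | h3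
    · exact absurd h3 h0
    · rw [h3]
      norm_num
      omega
    · rw [h3]
      norm_num
      omega
  have := dimSeries_eq (r := regionDim (unitFunctionals A T) (zonotopeBound A μ 0) (A.col '' T))
    (r₁ := fun _ => 0) (r₂ := regionDim (contract (unitFunctionals A T) (A.col v))
      (zonotopeBound A μ 0) (insert (A.col v) (A.col '' T)))
    (regionDim_zero ..) rfl (regionDim_zero ..) fun k => by
    rw [regionDim_succ hadm (SlabGenerated.of_slab_eq_empty hh hempty) k,
      regionDim_of_region_eq_empty (region_eq_empty (fun _ => neg_mem_unitFunctionals) hh hempty)]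
  rw [zonotopeSeries, this, regionDim_contract_zonotope _ μ _ _ _ fun _ _ => rfl, zonotopeSeries]
  have h1 : dimSeries (fun _ => 0) = 0 := by
    ext j
    simp [dimSeries]
  rw [h1, mul_zero, zero_add]

/-- The interior has no lattice points if some unit functional has width at most one. -/
theorem zonotopeSeries_eq_zero (μ : Fin n → ℕ) {T : Set (Fin n)}
    (hthin : ∃ h ∈ unitFunctionals A T, ∑ i, μ i * |h (A.col i)| ≤ 1) :
    zonotopeSeries A μ 1 T = 0 := by
  obtain ⟨h, hh, hsum⟩ := hthin
  have hempty : region (unitFunctionals A T) (zonotopeBound A μ 1) = ∅ :=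
    region_eq_empty (fun _ => neg_mem_unitFunctionals) hh (by
      rw [zonotopeBound_add_neg]
      omega)
  ext j
  simp [zonotopeSeries, dimSeries, regionDim_of_region_eq_empty hempty]

end Zonotope

/-! ### Facet inequalities of unimodular zonotopes -/

section Facets

variable {d n : ℕ} {A : Matrix (Fin d) (Fin n) ℤ}

/-- The value at a real point of the real extension of an integral functional. -/
def realEval {d : ℕ} (x : Fin d → ℝ) : ((Fin d → ℤ) →+ ℤ) →+ ℝ where
  toFun h := ∑ j, x j * h (Pi.single j 1)
  map_zero' := by simp
  map_add' g h := by simp [mul_add, Finset.sum_add_distrib]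

theorem realEval_apply (x : Fin d → ℝ) (h : (Fin d → ℤ) →+ ℤ) :
    realEval x h = ∑ j, x j * h (Pi.single j 1) := rfl

theorem realEval_intCast (z : Fin d → ℤ) (h : (Fin d → ℤ) →+ ℤ) :
    realEval (fun i => (z i : ℝ)) h = h z := by
  conv_rhs => rw [← Finset.univ_sum_single z]
  rw [map_sum, Int.cast_sum, realEval_apply]
  refine Finset.sum_congr rfl fun i _ => ?_
  rw [show Pi.single i (z i) = z i • (Pi.single i 1 : Fin d → ℤ) by
    rw [← Pi.single_smul, smul_eq_mul, mul_one], map_zsmul, smul_eq_mul, Int.cast_mul]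

theorem realEval_add (x y : Fin d → ℝ) (h : (Fin d → ℤ) →+ ℤ) :
    realEval (x + y) h = realEval x h + realEval y h := by
  simp [realEval_apply, add_mul, Finset.sum_add_distrib]

theorem realEval_smul (c : ℝ) (x : Fin d → ℝ) (h : (Fin d → ℤ) →+ ℤ) :
    realEval (c • x) h = c * realEval x h := by
  simp [realEval_apply, Finset.mul_sum, mul_assoc]

theorem realEval_mulVec (t : Fin n → ℝ) (h : (Fin d → ℤ) →+ ℤ) :
    realEval ((A.map (Int.cast : ℤ → ℝ)).mulVec t) h = ∑ i, t i * h (A.col i) := by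
  have : ∀ i, (h (A.col i) : ℝ) = ∑ j, (A j i : ℝ) * h (Pi.single j 1) := fun i =>
    (realEval_intCast (A.col i) h).symm
  simp only [this, realEval_apply, Matrix.mulVec, dotProduct, Matrix.map_apply, Finset.sum_mul,
    Finset.mul_sum]
  rw [Finset.sum_comm]
  exact Finset.sum_congr rfl fun i _ => Finset.sum_congr rfl fun j _ => by ring

/-- The zonotope `{∑ tᵢ aᵢ | 0 ≤ tᵢ ≤ wᵢ}`. -/
def weightedZonotope (A : Matrix (Fin d) (Fin n) ℤ) (w : Fin n → ℝ) : Set (Fin d → ℝ) :=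
  {x | ∃ t : Fin n → ℝ, (∀ i, 0 ≤ t i ∧ t i ≤ w i) ∧ (A.map (Int.cast : ℤ → ℝ)).mulVec t = x}

theorem realEval_le_of_mem {w : Fin n → ℝ} {x : Fin d → ℝ} (hx : x ∈ weightedZonotope A w)
    (h : (Fin d → ℤ) →+ ℤ) : realEval x h ≤ supportBound A w h := by
  obtain ⟨t, ht, rfl⟩ := hx
  rw [realEval_mulVec, supportBound]
  refine Finset.sum_le_sum fun i _ => ?_
  calc t i * (h (A.col i) : ℝ) ≤ t i * ((max (h (A.col i)) 0 : ℤ) : ℝ) :=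
        mul_le_mul_of_nonneg_left (by exact_mod_cast le_max_left _ _) (ht i).1
    _ ≤ w i * ((max (h (A.col i)) 0 : ℤ) : ℝ) :=
        mul_le_mul_of_nonneg_right (ht i).2 (by exact_mod_cast le_max_right _ _)

theorem realEval_le_supportBound (hA : IsUnimodularMatrix A) {w : Fin n → ℝ} (hw : ∀ i, 0 ≤ w i)
    {x : Fin d → ℝ} (hx : ∀ h ∈ unitFunctionals A ∅, realEval x h ≤ supportBound A w h)
    (g : (Fin d → ℤ) →+ ℤ) : realEval x g ≤ supportBound A w g := by
  rcases eq_or_ne g 0 with rfl | hg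
  · rw [map_zero]
    exact supportBound_nonneg hw 0
  · have := le_supportBound_of_unit hA (ε := 0) le_rfl (L := realEval x) (T := ∅) (w := w)
      (fun h hh => by simpa using hx h hh) hg (by simp)
    simpa using this

/-- A point satisfying the inequalities of the unit functionals lies in the zonotope. The segments
are split off one after the other, by Helly's theorem on the line. -/
theorem mem_weightedZonotope (hA : IsUnimodularMatrix A) {w : Fin n → ℝ} (hw : ∀ i, 0 ≤ w i)
    {x : Fin d → ℝ} (hx : ∀ h ∈ unitFunctionals A ∅, realEval x h ≤ supportBound A w h) :
    x ∈ weightedZonotope A w := by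
  suffices H : ∀ (S : Finset (Fin n)) (w : Fin n → ℝ) (x : Fin d → ℝ), (∀ i, 0 ≤ w i) →
      (∀ i, i ∉ S → w i = 0) →
      (∀ h ∈ unitFunctionals A ∅, realEval x h ≤ supportBound A w h) →
      x ∈ weightedZonotope A w from H Finset.univ w x hw (by simp) hx
  clear hx hw x w
  intro S
  induction S using Finset.induction_on with
  | empty =>
    intro w x hw hS hx
    have h0 : ∀ h, supportBound A w h = 0 := fun h =>
      Finset.sum_eq_zero fun i _ => by rw [hS i (by simp), zero_mul]
    have hx0 : x = 0 := by
      ext j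
      have h1 := realEval_le_supportBound hA hw hx (Pi.evalAddMonoidHom (fun _ => ℤ) j)
      have h2 := realEval_le_supportBound hA hw hx (-Pi.evalAddMonoidHom (fun _ => ℤ) j)
      rw [map_neg] at h2
      have h3 : realEval x (Pi.evalAddMonoidHom (fun _ => ℤ) j) = x j := by
        simp [realEval_apply, Pi.single_apply]
      rw [h0, h3] at h1 h2
      exact le_antisymm h1 (by simpa using h2)
    exact ⟨0, fun i => ⟨le_rfl, hw i⟩, by rw [hx0, Matrix.mulVec_zero]⟩
  | insert v S hv ih =>
    intro w x hw hS hx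
    -- the coefficient `t` of the column `v`: the bounds make `x - t • aᵥ` satisfy the inequalities
    -- of the zonotope without this column
    obtain ⟨t, htl, htu⟩ := exists_between_of_forall_le
      (s := insert 0 {r | ∃ h ∈ unitFunctionals A ∅, h (A.col v) = 1 ∧
        r = realEval x h - supportBound A w h + w v})
      (t := insert (w v) {r | ∃ h ∈ unitFunctionals A ∅, h (A.col v) = -1 ∧
        r = supportBound A w h - realEval x h})
      (Set.insert_nonempty _ _) (Set.insert_nonempty _ _) (by
        rintro r (rfl | ⟨h, hh, hv1, rfl⟩) s (rfl | ⟨h', hh', hv1', rfl⟩)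
        · exact hw v
        · exact sub_nonneg.2 (hx h' hh')
        · linarith [hx h hh]
        · have h1 := realEval_le_supportBound hA hw hx (h + h')
          rw [map_add] at h1
          linarith [supportBound_add_add_le hw hv1 hv1'])
    have ht0 : 0 ≤ t := htl (Set.mem_insert _ _)
    have htw : t ≤ w v := htu (Set.mem_insert _ _)
    have hw' : ∀ i, 0 ≤ Function.update w v 0 i := fun i => by
      rcases eq_or_ne i v with rfl | hi
      · simp
      · simpa [hi] using hw i
    have hbound : ∀ h, supportBound A (Function.update w v 0) h =
        supportBound A w h - w v * ((max (h (A.col v)) 0 : ℤ) : ℝ) := fun h => by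
      rw [supportBound, supportBound, ← Finset.add_sum_erase _ _ (Finset.mem_univ v),
        ← Finset.add_sum_erase (a := v) _ (fun i => w i * ((max (h (A.col i)) 0 : ℤ) : ℝ))
          (Finset.mem_univ v), Function.update_self, zero_mul, zero_add, add_sub_cancel_left]
      exact Finset.sum_congr rfl fun i hi => by
        rw [Function.update_of_ne (Finset.ne_of_mem_erase hi)]
    obtain ⟨u, hu, hux⟩ := ih (Function.update w v 0)
      (x + (-t) • (A.map (Int.cast : ℤ → ℝ)).mulVec (Pi.single v 1)) hw'
      (fun i hi => by
        rcases eq_or_ne i v with rfl | hiv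
        · simp
        · simpa [hiv] using hS i (by simp [hiv, hi]))
      (fun h hh => by
        have h1 : realEval ((A.map (Int.cast : ℤ → ℝ)).mulVec (Pi.single v 1)) h =
            h (A.col v) := by
          rw [realEval_mulVec]
          simp [Pi.single_apply]
        rw [realEval_add, realEval_smul, h1, hbound]
        rcases hh.2.1 v with h2 | h2 | h2
        · simpa [h2] using hx h hh
        · have := htl (Set.mem_insert_of_mem _ ⟨h, hh, h2, rfl⟩)
          rw [h2]
          norm_num
          linarith
        · have := htu (Set.mem_insert_of_mem _ ⟨h, hh, h2, rfl⟩)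
          rw [h2]
          norm_num
          linarith)
    have huv : u v = 0 := le_antisymm (by simpa using (hu v).2) (hu v).1
    refine ⟨u + t • Pi.single v 1, fun i => ?_, ?_⟩
    · rcases eq_or_ne i v with rfl | hi
      · simpa [huv] using ⟨ht0, htw⟩
      · simpa [hi] using hu i
    · rw [Matrix.mulVec_add, hux, Matrix.mulVec_smul]
      module

theorem smul_zonotope (A : Matrix (Fin d) (Fin n) ℤ) (m : ℕ) :
    (m : ℝ) • zonotope A = weightedZonotope A fun _ => m := by
  ext x
  constructor
  · rintro ⟨_, ⟨y, hy, rfl⟩, rfl⟩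
    refine ⟨(m : ℝ) • y, fun i => ?_, ?_⟩
    · have h0 := hy.1 i
      have h1 := hy.2 i
      simp only [Pi.zero_apply, Pi.one_apply] at h0 h1
      simp only [Pi.smul_apply, smul_eq_mul]
      exact ⟨by positivity, mul_le_of_le_one_right (Nat.cast_nonneg m) h1⟩
    · rw [Matrix.mulVec_smul]
  · rintro ⟨t, ht, rfl⟩
    refine ⟨(A.map (Int.cast : ℤ → ℝ)).mulVec ((m : ℝ)⁻¹ • t),
      ⟨_, ⟨fun i => ?_, fun i => ?_⟩, rfl⟩, ?_⟩
    · have := (ht i).1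
      simp only [Pi.zero_apply, Pi.smul_apply, smul_eq_mul]
      positivity
    · simp only [Pi.one_apply, Pi.smul_apply, smul_eq_mul]
      exact inv_mul_le_one_of_le₀ (ht i).2 (Nat.cast_nonneg m)
    · change (m : ℝ) • _ = _
      rw [← Matrix.mulVec_smul, smul_smul]
      rcases Nat.eq_zero_or_pos m with rfl | hm
      · have : t = 0 := funext fun i => le_antisymm (by simpa using (ht i).2) (ht i).1
        simp [this]
      · rw [mul_inv_cancel₀ (by positivity), one_smul]

theorem finite_unitFunctionals (hA : IsUnimodularMatrix A) : (unitFunctionals A ∅).Finite := by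
  obtain ⟨c, hc⟩ := exists_det_submatrix_ne_zero hA
  refine Set.Finite.of_finite_image (f := fun h i => h (A.col i))
    ((Set.Finite.pi' fun _ : Fin n => Set.toFinite ({0, 1, -1} : Set ℤ)).subset ?_) ?_
  · rintro _ ⟨h, hh, rfl⟩ i
    simpa using hh.2.1 i
  · intro g _ h _ hgh
    refine sub_eq_zero.1 (eq_zero_of_forall_col hc fun k => ?_)
    simpa [sub_eq_zero] using congrFun hgh (c k)

theorem continuous_realEval (h : (Fin d → ℤ) →+ ℤ) : Continuous fun x => realEval x h := by
  simp only [realEval_apply]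
  fun_prop

theorem mem_interior_weightedZonotope (hA : IsUnimodularMatrix A) {w : Fin n → ℝ}
    (hw : ∀ i, 0 ≤ w i) {x : Fin d → ℝ} : x ∈ interior (weightedZonotope A w) ↔
      ∀ h ∈ unitFunctionals A ∅, realEval x h < supportBound A w h := by
  constructor
  · intro hx h hh
    -- move `x` a little in the direction in which `h` increases
    have hpos : 0 < realEval (fun j => (h (Pi.single j 1) : ℝ)) h := by
      rw [realEval_apply]
      refine Finset.sum_pos' (fun j _ => mul_self_nonneg _) ?_
      by_contra! hall
      refine hh.1 (AddMonoidHom.ext fun y => ?_)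
      have h1 := realEval_intCast y h
      rw [realEval_apply, Finset.sum_eq_zero] at h1
      · exact_mod_cast h1.symm
      · intro j hj
        rw [mul_self_eq_zero.1 (le_antisymm (hall j hj) (mul_self_nonneg _)), mul_zero]
    have hcont : Filter.Tendsto (fun δ : ℝ => x + δ • fun j => (h (Pi.single j 1) : ℝ))
        (nhdsWithin 0 (Set.Ioi 0)) (nhds x) := by
      have : Continuous fun δ : ℝ => x + δ • fun j => (h (Pi.single j 1) : ℝ) := by fun_prop
      simpa using (this.tendsto 0).mono_left nhdsWithin_le_nhds
    obtain ⟨δ, hδ, hδ0⟩ := ((hcont.eventually (mem_interior_iff_mem_nhds.1 hx)).and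
      self_mem_nhdsWithin).exists
    have h1 := realEval_le_of_mem hδ h
    rw [realEval_add, realEval_smul] at h1
    have h2 := mul_pos (Set.mem_Ioi.1 hδ0) hpos
    linarith
  · intro hx
    refine mem_interior.2 ⟨⋂ h ∈ unitFunctionals A ∅, {y | realEval y h < supportBound A w h},
      fun y hy => mem_weightedZonotope hA hw fun h hh => (Set.mem_iInter₂.1 hy h hh).le,
      (finite_unitFunctionals hA).isOpen_biInter fun h _ =>
        isOpen_lt (continuous_realEval h) continuous_const, Set.mem_iInter₂.2 hx⟩

theorem supportBound_natCast (m : ℕ) (h : (Fin d → ℤ) →+ ℤ) :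
    supportBound A (fun _ => (m : ℝ)) h = (supportBound A (fun _ => (m : ℤ)) h : ℤ) := by
  simp [supportBound]

theorem intCast_mem_smul_zonotope (hA : IsUnimodularMatrix A) (m : ℕ) (z : Fin d → ℤ) :
    (fun i => (z i : ℝ)) ∈ (m : ℝ) • zonotope A ↔
      z ∈ region (unitFunctionals A ∅) (zonotopeBound A (fun _ => m) 0) := by
  have : ∀ h : (Fin d → ℤ) →+ ℤ, realEval (fun i => (z i : ℝ)) h ≤
      supportBound A (fun _ => (m : ℝ)) h ↔ h z ≤ zonotopeBound A (fun _ => m) 0 h := fun h => by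
    rw [realEval_intCast, supportBound_natCast, Int.cast_le, zonotopeBound, sub_zero]
  rw [smul_zonotope]
  exact ⟨fun hz h hh => (this h).1 (realEval_le_of_mem hz h), fun hz =>
    mem_weightedZonotope hA (fun _ => Nat.cast_nonneg m) fun h hh => (this h).2 (hz h hh)⟩

theorem intCast_mem_interior_smul_zonotope (hA : IsUnimodularMatrix A) (m : ℕ) (z : Fin d → ℤ) :
    (fun i => (z i : ℝ)) ∈ interior ((m : ℝ) • zonotope A) ↔
      z ∈ region (unitFunctionals A ∅) (zonotopeBound A (fun _ => m) 1) := by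
  rw [smul_zonotope, mem_interior_weightedZonotope hA fun _ => Nat.cast_nonneg m]
  refine forall₂_congr fun h hh => ?_
  rw [realEval_intCast, supportBound_natCast, Int.cast_lt, zonotopeBound, Int.le_sub_one_iff]

end Facets

/-! ### Hilbert series of orbit harmonics rings -/

section OrbitHarmonics

open MvPolynomial

variable {d : ℕ}

theorem mem_polyLT {k : ℕ} {p : MvPolynomial (Fin d) ℂ} :
    p ∈ polyLT d k ↔ ∀ m, coeff m p ≠ 0 → m.degree < k := by
  rw [polyLT, mem_restrictSupport_iff]
  exact ⟨fun h m hm => h (mem_support_iff.2 hm), fun h m hm => h m (mem_support_iff.1 hm)⟩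

instance polyLT_finiteDimensional (d k : ℕ) : FiniteDimensional ℂ (polyLT d k) := by
  have : Finite {m : Fin d →₀ ℕ | m.degree < k} := (Finsupp.finite_of_degree_lt k).to_subtype
  exact Module.Finite.of_basis (basisRestrictSupport ℂ {m : Fin d →₀ ℕ | m.degree < k})

theorem homogeneousComponent_monomial_mul (j : ℕ) (s : Fin d →₀ ℕ) (c : ℂ)
    (p : MvPolynomial (Fin d) ℂ) : homogeneousComponent j (monomial s c * p) =
      if s.degree ≤ j then monomial s c * homogeneousComponent (j - s.degree) p else 0 := by
  ext m
  rw [coeff_homogeneousComponent, coeff_monomial_mul']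
  split_ifs with h1 h2 h3 h3
  · rw [coeff_monomial_mul', if_pos h2, coeff_homogeneousComponent, if_pos]
    have := congrArg Finsupp.degree (tsub_add_cancel_of_le h2)
    rw [map_add] at this
    omega
  · have := congrArg Finsupp.degree (tsub_add_cancel_of_le h2)
    rw [map_add] at this
    omega
  · rw [coeff_monomial_mul', if_neg h2]
  · rw [coeff_zero]
  · rw [coeff_monomial_mul']
    split_ifs with h2
    · rw [coeff_homogeneousComponent, if_neg, mul_zero]
      have := congrArg Finsupp.degree (tsub_add_cancel_of_le h2)
      rw [map_add] at this
      omega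
    · rfl
  · rw [coeff_zero]

/-- The degree `j` components of the elements of degree at most `j` of an ideal. -/
noncomputable def initialForms (I : Ideal (MvPolynomial (Fin d) ℂ)) (j : ℕ) :
    Submodule ℂ (MvPolynomial (Fin d) ℂ) :=
  (polyLT d (j + 1) ⊓ I.restrictScalars ℂ).map (homogeneousComponent j)

theorem homogeneousComponent_mem_initialForms {I : Ideal (MvPolynomial (Fin d) ℂ)}
    {f : MvPolynomial (Fin d) ℂ} (hf : f ∈ grIdeal I) (j : ℕ) :
    homogeneousComponent j f ∈ initialForms I j := by
  induction hf using Submodule.span_induction generalizing j with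
  | mem f hf =>
    obtain ⟨F, hF, rfl⟩ := hf
    rw [homogeneousComponent_of_mem (homogeneousComponent_mem _ _)]
    split_ifs with hj
    · refine ⟨F, ⟨mem_polyLT.2 fun m hm => ?_, hF⟩, by rw [hj]⟩
      exact Nat.lt_succ_of_le (hj ▸ le_totalDegree (mem_support_iff.2 hm))
    · exact zero_mem _
  | zero => simp
  | add f g _ _ hf hg =>
    rw [map_add]
    exact add_mem (hf j) (hg j)
  | smul a f _ hf =>
    rw [smul_eq_mul]
    induction a using MvPolynomial.induction_on' with
    | monomial s c =>
      rw [homogeneousComponent_monomial_mul]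
      split_ifs with hs
      · obtain ⟨F, ⟨hF, hFI⟩, hFf⟩ := hf (j - s.degree)
        refine ⟨monomial s c * F, ⟨mem_polyLT.2 fun m hm => ?_, I.mul_mem_left _ hFI⟩, ?_⟩
        · rw [coeff_monomial_mul'] at hm
          split_ifs at hm with h2
          · have h3 := mem_polyLT.1 hF _ (right_ne_zero_of_mul hm)
            have := congrArg Finsupp.degree (tsub_add_cancel_of_le h2)
            rw [map_add] at this
            omega
          · exact absurd rfl hm
        · rw [homogeneousComponent_monomial_mul, if_pos hs, hFf]
      · exact zero_mem _
    | add p q hp hq =>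
      rw [add_mul, map_add]
      exact add_mem hp hq

/-- Passing to the ideal generated by the top degree components adds no new forms of degree `j`. -/
theorem homogeneousSubmodule_inf_grIdeal (I : Ideal (MvPolynomial (Fin d) ℂ)) (j : ℕ) :
    homogeneousSubmodule (Fin d) ℂ j ⊓ (grIdeal I).restrictScalars ℂ = initialForms I j := by
  refine le_antisymm ?_ ?_
  · rintro f ⟨hf, hfI⟩
    have := homogeneousComponent_mem_initialForms hfI j
    rwa [homogeneousComponent_eq_self hf] at this
  · rintro _ ⟨F, ⟨hF, hFI⟩, rfl⟩
    refine ⟨homogeneousComponent_mem _ _, ?_⟩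
    rcases lt_or_ge F.totalDegree j with hj | hj
    · rw [homogeneousComponent_eq_zero _ _ hj]
      exact zero_mem _
    · have : F.totalDegree = j := le_antisymm (Finset.sup_le fun m hm =>
        Nat.lt_succ_iff.1 (mem_polyLT.1 hF m (mem_support_iff.1 hm))) hj
      exact Ideal.subset_span ⟨F, hFI, by rw [this]⟩

theorem polyLT_inf_ker_homogeneousComponent (j : ℕ) :
    polyLT d (j + 1) ⊓ LinearMap.ker (homogeneousComponent j) = polyLT d j := by
  ext p
  simp only [Submodule.mem_inf, mem_polyLT, LinearMap.mem_ker]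
  refine ⟨fun h m hm => lt_of_le_of_ne (Nat.lt_succ_iff.1 (h.1 m hm)) fun hj => hm ?_,
    fun h => ⟨fun m hm => (h m hm).trans (Nat.lt_succ_self j), ?_⟩⟩
  · have := congrArg (coeff m) h.2
    rwa [coeff_homogeneousComponent, if_pos hj, coeff_zero] at this
  · ext m
    rw [coeff_homogeneousComponent, coeff_zero]
    split_ifs with hj
    · by_contra hm
      exact (h m hm).ne hj
    · rfl

theorem map_homogeneousComponent_polyLT (j : ℕ) :
    (polyLT d (j + 1)).map (homogeneousComponent j) = homogeneousSubmodule (Fin d) ℂ j := by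
  refine le_antisymm (Submodule.map_le_iff_le_comap.2 fun p _ => homogeneousComponent_mem _ _)
    fun p hp => ⟨p, mem_polyLT.2 fun m hm => ?_, homogeneousComponent_eq_self hp⟩
  have := ((mem_homogeneousSubmodule _ _).1 hp).totalDegree_le
  exact Nat.lt_succ_of_le ((le_totalDegree (mem_support_iff.2 hm)).trans this)

/-- The dimension of a graded piece of `Orb S`, in terms of the dimensions of the spaces of
polynomials of bounded degree and of those among them that vanish on `S`. -/
theorem finrank_orbPiece (S : Set (Fin d → ℂ)) (j : ℕ) :
    Module.finrank ℂ (orbPiece S j) + Module.finrank ℂ (polyLT d j) +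
      Module.finrank ℂ (polyLT d (j + 1) ⊓
        (vanishingIdeal ℂ S).restrictScalars ℂ : Submodule ℂ _) =
    Module.finrank ℂ (polyLT d (j + 1)) +
      Module.finrank ℂ (polyLT d j ⊓ (vanishingIdeal ℂ S).restrictScalars ℂ : Submodule ℂ _) := by
  have fin : FiniteDimensional ℂ (homogeneousSubmodule (Fin d) ℂ j) := by
    rw [← map_homogeneousComponent_polyLT]
    infer_instance
  have fin' : FiniteDimensional ℂ
      (polyLT d (j + 1) ⊓ (vanishingIdeal ℂ S).restrictScalars ℂ : Submodule ℂ _) :=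
    Submodule.finiteDimensional_inf_left _ _
  have h1 := finrank_map_add_finrank_inf_ker (polyLT d (j + 1)) (homogeneousComponent j)
  rw [polyLT_inf_ker_homogeneousComponent, map_homogeneousComponent_polyLT] at h1
  have h2 := finrank_map_add_finrank_inf_ker
    (polyLT d (j + 1) ⊓ (vanishingIdeal ℂ S).restrictScalars ℂ) (homogeneousComponent j)
  rw [inf_right_comm, polyLT_inf_ker_homogeneousComponent] at h2
  have h3 := finrank_map_add_finrank_inf_ker (homogeneousSubmodule (Fin d) ℂ j)
    (Ideal.Quotient.mkₐ ℂ (grIdeal (vanishingIdeal ℂ S))).toLinearMap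
  have hker : LinearMap.ker (Ideal.Quotient.mkₐ ℂ (grIdeal (vanishingIdeal ℂ S))).toLinearMap =
      (grIdeal (vanishingIdeal ℂ S)).restrictScalars ℂ := by
    ext p
    exact Ideal.Quotient.eq_zero_iff_mem
  rw [hker, homogeneousSubmodule_inf_grIdeal, initialForms] at h3
  have h4 : Module.finrank ℂ (orbPiece S j) + Module.finrank ℂ
      ((polyLT d (j + 1) ⊓ (vanishingIdeal ℂ S).restrictScalars ℂ : Submodule ℂ _).map
        (homogeneousComponent j)) = Module.finrank ℂ (homogeneousSubmodule (Fin d) ℂ j) := h3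
  omega

theorem vanishingIdeal_eq_ker (S : Set (Fin d → ℤ)) :
    (vanishingIdeal ℂ {x : Fin d → ℂ | ∃ z ∈ S, x = fun i => (z i : ℂ)}).restrictScalars ℂ =
      LinearMap.ker ((LinearMap.funLeft ℂ ℂ ((↑) : S → Fin d → ℤ)).comp (evalInt d)) := by
  ext p
  rw [LinearMap.mem_ker, funext_iff, Submodule.restrictScalars_mem, mem_vanishingIdeal_iff]
  constructor
  · rintro h ⟨z, hz⟩
    have := h _ ⟨z, hz, rfl⟩
    rwa [aeval_eq_eval] at this
  · rintro h _ ⟨z, hz, rfl⟩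
    rw [aeval_eq_eval]
    exact h ⟨z, hz⟩

/-- The Hilbert series of the orbit harmonics ring of a set of lattice points records the
dimensions of the spaces of polynomial functions of bounded degree on this set. -/
theorem orbHilb_eq (S : Set (Fin d → ℤ)) :
    orbHilb {x : Fin d → ℂ | ∃ z ∈ S, x = fun i => (z i : ℂ)} =
      dimSeries fun k => Module.finrank ℂ
        ((polyFun (Fin d → ℤ) k).map (LinearMap.funLeft ℂ ℂ ((↑) : S → Fin d → ℤ))) := by
  have hdim : ∀ k, Module.finrank ℂ
      ((polyFun (Fin d → ℤ) k).map (LinearMap.funLeft ℂ ℂ ((↑) : S → Fin d → ℤ))) +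
      Module.finrank ℂ (polyLT d k ⊓ (vanishingIdeal ℂ
        {x : Fin d → ℂ | ∃ z ∈ S, x = fun i => (z i : ℂ)}).restrictScalars ℂ : Submodule ℂ _) =
      Module.finrank ℂ (polyLT d k) := fun k => by
    rw [vanishingIdeal_eq_ker, ← map_polyLT, ← Submodule.map_comp]
    exact finrank_map_add_finrank_inf_ker _ _
  ext j
  rw [orbHilb, dimSeries, PowerSeries.coeff_mk, PowerSeries.coeff_mk]
  have h1 := hdim j
  have h2 := hdim (j + 1)
  have h3 := finrank_orbPiece {x : Fin d → ℂ | ∃ z ∈ S, x = fun i => (z i : ℂ)} j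
  omega

end OrbitHarmonics

section Count

variable {d n : ℕ} {A : Matrix (Fin d) (Fin n) ℤ}

theorem zonotopeSeries_empty (μ : Fin n → ℕ) (ε : ℤ) : zonotopeSeries A μ ε ∅ =
    orbHilb {x : Fin d → ℂ | ∃ z ∈ region (unitFunctionals A ∅) (zonotopeBound A μ ε),
      x = fun i => (z i : ℂ)} := by
  have : ∀ k, invPoly (A.col '' ∅) k = polyFun (Fin d → ℤ) k := fun k => by
    ext f
    simp [mem_invPoly]
  rw [orbHilb_eq, zonotopeSeries]
  congr 1
  funext k
  rw [regionDim, this]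

theorem gradedCount_zonotope (hA : IsUnimodularMatrix A) (m : ℕ) :
    gradedCount (zonotope A) m = zonotopeSeries A (fun _ => m) 0 ∅ := by
  rw [gradedCount, latticeLocus, zonotopeSeries_empty]
  simp only [intCast_mem_smul_zonotope hA]

theorem gradedInteriorCount_zonotope (hA : IsUnimodularMatrix A) (m : ℕ) :
    gradedInteriorCount (zonotope A) m = zonotopeSeries A (fun _ => m) 1 ∅ := by
  rw [gradedInteriorCount, latticeLocus, zonotopeSeries_empty]
  simp only [intCast_mem_interior_smul_zonotope hA]

end Count

/-! ### The graded counts as polynomials in `q ^ m` -/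

section Corank

variable {d n : ℕ} {A : Matrix (Fin d) (Fin n) ℤ}

/-- The functionals vanishing on the columns in `T`. -/
def annihilator (A : Matrix (Fin d) (Fin n) ℤ) (T : Set (Fin n)) :
    Submodule ℤ ((Fin d → ℤ) →+ ℤ) where
  carrier := {h | ∀ i ∈ T, h (A.col i) = 0}
  add_mem' hf hg i hi := by simp [hf i hi, hg i hi]
  zero_mem' _ _ := rfl
  smul_mem' r f hf i hi := by simp [hf i hi]

/-- The corank `d - rank T` of a set of columns. -/
noncomputable def corank (A : Matrix (Fin d) (Fin n) ℤ) (T : Set (Fin n)) : ℕ :=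
  Module.finrank ℤ (annihilator A T)

theorem exists_mem_unitFunctionals (hA : IsUnimodularMatrix A) {T : Set (Fin n)}
    {g : (Fin d → ℤ) →+ ℤ} (hg : g ≠ 0) (hgT : g ∈ annihilator A T) :
    ∃ h ∈ unitFunctionals A T, Conformal A h g := by
  obtain ⟨h, hh0, hconf, hval⟩ := exists_conformal_unit hA hg
  refine ⟨h, ⟨hh0, hval, fun i hi => ?_⟩, hconf⟩
  rcases hconf i with h1 | h1
  · exact h1
  · simp [hgT i hi] at h1

theorem annihilator_eq_bot (hA : IsUnimodularMatrix A) {T : Set (Fin n)}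
    (hT : unitFunctionals A T = ∅) : annihilator A T = ⊥ := by
  refine (Submodule.eq_bot_iff _).2 fun g hg => ?_
  by_contra hne
  obtain ⟨h, hh, -⟩ := exists_mem_unitFunctionals hA hne hg
  simp [hT] at hh

theorem exists_col_ne_zero (hA : IsUnimodularMatrix A) {h : (Fin d → ℤ) →+ ℤ} (hh : h ≠ 0) :
    ∃ v, h (A.col v) ≠ 0 := by
  by_contra! hall
  obtain ⟨c, hc⟩ := exists_det_submatrix_ne_zero hA
  exact hh (eq_zero_of_forall_col hc fun k => hall (c k))

instance finite_functionals (d : ℕ) : Module.Finite ℤ ((Fin d → ℤ) →+ ℤ) :=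
  Module.Finite.equiv (addMonoidHomLequivInt (A := Fin d → ℤ) (B := ℤ) ℤ).symm

theorem corank_empty (A : Matrix (Fin d) (Fin n) ℤ) : corank A ∅ = d := by
  have : annihilator A ∅ = ⊤ := by
    ext h
    simp [annihilator]
  rw [corank, this, finrank_top,
    (addMonoidHomLequivInt (A := Fin d → ℤ) (B := ℤ) ℤ).finrank_eq, Module.finrank_linearMap]
  simp

theorem corank_eq_zero (hA : IsUnimodularMatrix A) {T : Set (Fin n)}
    (hT : unitFunctionals A T = ∅) : corank A T = 0 := by
  rw [corank, annihilator_eq_bot hA hT, finrank_bot]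

theorem corank_insert {T : Set (Fin n)} {v : Fin n} (hv : ¬IsLoop A T v) :
    corank A T = corank A (insert v T) + 1 := by
  obtain ⟨h, hh, hv0⟩ : ∃ h ∈ unitFunctionals A T, h (A.col v) ≠ 0 := by simpa [IsLoop] using hv
  let φ : ((Fin d → ℤ) →+ ℤ) →ₗ[ℤ] ℤ := (AddMonoidHom.eval (A.col v)).toIntLinearMap
  have hφ : ∀ g, φ g = g (A.col v) := fun g => rfl
  have h1 := Submodule.finrank_quotient_add_finrank
    (LinearMap.ker (φ.domRestrict (annihilator A T)))
  rw [(φ.domRestrict (annihilator A T)).quotKerEquivRange.finrank_eq] at h1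
  have h2 : (LinearMap.ker (φ.domRestrict (annihilator A T))).map (annihilator A T).subtype =
      annihilator A (insert v T) := by
    ext g
    rw [Submodule.mem_map]
    constructor
    · rintro ⟨⟨g, hg⟩, hgv, rfl⟩
      exact Set.forall_mem_insert.2 ⟨hgv, hg⟩
    · intro hg
      exact ⟨⟨g, fun i hi => hg i (Set.mem_insert_of_mem v hi)⟩, hg v (Set.mem_insert v T), rfl⟩
  have h3 : Module.finrank ℤ (LinearMap.range (φ.domRestrict (annihilator A T))) = 1 := by
    refine le_antisymm ((Submodule.finrank_le _).trans (Module.finrank_self ℤ).le) ?_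
    refine Nat.one_le_iff_ne_zero.2 fun h0 => hv0 ?_
    have h4 := Submodule.finrank_eq_zero.1 h0
    have h5 : φ.domRestrict (annihilator A T) ⟨h, hh.2.2⟩ ∈
      LinearMap.range (φ.domRestrict (annihilator A T)) := ⟨_, rfl⟩
    rw [h4] at h5
    exact (Submodule.mem_bot ℤ).1 h5
  rw [h3, ← Submodule.finrank_map_subtype_eq, h2] at h1
  rw [corank, corank, ← h1, add_comm]

/-- If no functional vanishes on the columns in `T`, they generate a subgroup of finite index. -/
theorem exists_zsmul_mem_span (hA : IsUnimodularMatrix A) {T : Set (Fin n)}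
    (hT : unitFunctionals A T = ∅) (w : Fin d → ℤ) :
    ∃ N : ℤ, N ≠ 0 ∧ N • w ∈ Submodule.span ℤ (A.col '' T) := by
  set C := Submodule.span ℤ (A.col '' T) with hC
  by_contra! hw
  let π : (Fin d → ℤ) →ₗ[ℤ] ((Fin d → ℤ) ⧸ C) ⧸ Submodule.torsion ℤ ((Fin d → ℤ) ⧸ C) :=
    (Submodule.mkQ _).comp C.mkQ
  have hπ : π w ≠ 0 := fun h0 => by
    have h1 : C.mkQ w ∈ Submodule.torsion ℤ ((Fin d → ℤ) ⧸ C) :=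
      (Submodule.Quotient.mk_eq_zero _).1 h0
    obtain ⟨N, hN⟩ := (Submodule.mem_torsion_iff _).1 h1
    refine hw N (nonZeroDivisors.ne_zero N.2) ((Submodule.Quotient.mk_eq_zero C).1 ?_)
    exact hN
  obtain ⟨f, hf⟩ : ∃ f : Module.Dual ℤ _, f (π w) ≠ 0 := by
    by_contra! hall
    exact hπ ((Module.forall_dual_apply_eq_zero_iff ℤ _).1 hall)
  have hg : (f.comp π).toAddMonoidHom ∈ annihilator A T := fun i hi => by
    have h1 : C.mkQ (A.col i) = 0 := (Submodule.Quotient.mk_eq_zero C).2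
      (Submodule.subset_span ⟨i, hi, rfl⟩)
    change f (Submodule.mkQ _ (C.mkQ (A.col i))) = 0
    rw [h1, map_zero, map_zero]
  rw [annihilator_eq_bot hA hT] at hg
  exact hf (congrArg (fun h : (Fin d → ℤ) →+ ℤ => h w) ((Submodule.mem_bot ℤ).1 hg))

/-- If the columns in `T` span, only the constants are invariant under translation by them. -/
theorem zonotopeSeries_eq_one_of_spanning (hA : IsUnimodularMatrix A) {T : Set (Fin n)}
    (hT : unitFunctionals A T = ∅) (μ : Fin n → ℕ) (ε : ℤ) : zonotopeSeries A μ ε T = 1 := by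
  have hinv : ∀ f ∈ invariantFun (A.col '' T), ∀ c ∈ Submodule.span ℤ (A.col '' T),
      ∀ x, f (x + c) = f x := by
    intro f hf c hc
    induction hc using Submodule.span_induction with
    | mem c hc => exact hf c hc
    | zero => simp
    | add a b _ _ ha hb => exact fun x => by rw [← add_assoc, hb, ha]
    | smul r a _ ha => exact invariant_zsmul ha r
  have hconst : ∀ k, ∀ f ∈ invPoly (A.col '' T) k, ∀ x, f x = f 0 := by
    intro k
    induction k with
    | zero =>
      intro f hf x
      rw [show f = 0 from hf.1]
      rfl
    | succ k ih =>
      intro f hf x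
      -- the difference of `f` in any direction is a constant, which has a multiple equal to zero
      obtain ⟨N, hN, hNx⟩ := exists_zsmul_mem_span hA hT x
      have hd := ih _ (diffMap_mem_invPoly hf x)
      simp only [diffMap_apply, zero_add] at hd
      have hstep : ∀ j : ℤ, f (j • x) = f 0 + j * (f x - f 0) := fun j => by
        induction j using Int.induction_on with
        | zero => simp
        | succ i ihi =>
          have := hd ((i : ℤ) • x)
          rw [add_smul, one_smul, ← sub_add_cancel (f ((i : ℤ) • x + x)) (f ((i : ℤ) • x)), this,
            ihi]
          push_cast
          ring
        | pred i ihi =>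
          have := hd ((-(i : ℤ) - 1) • x)
          rw [← add_one_zsmul, sub_add_cancel, ihi] at this
          push_cast
          push_cast at this
          linear_combination -this
      have h1 := hstep N
      have h2 := hinv f hf.2 _ hNx 0
      rw [zero_add] at h2
      rw [h2, left_eq_add, mul_eq_zero] at h1
      rcases h1 with h1 | h1
      · exact absurd (by exact_mod_cast h1) hN
      · exact sub_eq_zero.1 h1
  have hspan : ∀ k, invPoly (A.col '' T) (k + 1) = Submodule.span ℂ {fun _ => 1} := fun k => by
    ext f
    rw [Submodule.mem_span_singleton]
    constructor
    · intro hf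
      exact ⟨f 0, funext fun x => by simp [hconst _ f hf x]⟩
    · rintro ⟨c, rfl⟩
      exact Submodule.smul_mem _ _ ⟨const_mem_polyFun 1 k, fun _ _ _ => rfl⟩
  have hdim : ∀ k, regionDim (unitFunctionals A T) (zonotopeBound A μ ε) (A.col '' T) (k + 1) =
      1 := fun k => by
    rw [regionDim, hspan, Submodule.map_span, Set.image_singleton]
    refine finrank_span_singleton fun h0 => ?_
    have := congrFun h0 ⟨0, by simp [region, hT]⟩
    simp [LinearMap.funLeft_apply] at this
  ext j
  rw [zonotopeSeries, dimSeries, PowerSeries.coeff_mk, PowerSeries.coeff_one]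
  cases j with
  | zero => simp [hdim, regionDim_zero]
  | succ j => simp [hdim]

/-- Columns of multiplicity zero can be contracted until the contracted columns span. -/
theorem zonotopeSeries_zero (hA : IsUnimodularMatrix A) (T : Set (Fin n)) :
    zonotopeSeries A 0 0 T = 1 := by
  induction hN : Tᶜ.ncard using Nat.strong_induction_on generalizing T with
  | _ N ih =>
  rcases Set.eq_empty_or_nonempty (unitFunctionals A T) with hT | ⟨h, hh⟩
  · exact zonotopeSeries_eq_one_of_spanning hA hT 0 0
  · obtain ⟨v, hv⟩ := exists_col_ne_zero hA hh.1
    have hvT : v ∉ T := fun hvT => hv (hh.2.2 v hvT)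
    rw [zonotopeSeries_insert_of_coloop hA 0 ⟨h, hh, hv, by simp⟩]
    refine ih _ ?_ (insert v T) rfl
    rw [← hN]
    exact Set.ncard_lt_ncard ⟨Set.compl_subset_compl.2 (Set.subset_insert v T), fun hsub =>
      hsub hvT (Set.mem_insert v T)⟩ (Set.toFinite _)

end Corank

section Recursion

variable {d n : ℕ} {A : Matrix (Fin d) (Fin n) ℤ} {K : Type*} [Field K] {θ : K →+* K} {q : K}

/-- The power series `s` is a polynomial whose value at `q` is `x`. -/
def HasValue (q : K) (s : PowerSeries ℤ) (x : K) : Prop :=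
  ∃ a : Polynomial ℤ, (a : PowerSeries ℤ) = s ∧ Polynomial.eval₂RingHom (Int.castRingHom K) q a = x

theorem HasValue.add {s s' : PowerSeries ℤ} {x x' : K} (h : HasValue q s x)
    (h' : HasValue q s' x') : HasValue q (s + s') (x + x') := by
  obtain ⟨a, rfl, rfl⟩ := h
  obtain ⟨b, rfl, rfl⟩ := h'
  exact ⟨a + b, by simp, by simp⟩

theorem HasValue.X_mul {s : PowerSeries ℤ} {x : K} (h : HasValue q s x) :
    HasValue q (PowerSeries.X * s) (q * x) := by
  obtain ⟨a, rfl, rfl⟩ := h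
  exact ⟨Polynomial.X * a, by simp, by simp⟩

theorem hasValue_one : HasValue q 1 1 := ⟨1, by simp, by simp⟩

theorem hasValue_zero : HasValue q 0 0 := ⟨0, by simp, by simp⟩

theorem HasValue.recursion (hq1 : 1 - q ≠ 0) {s : ℕ → PowerSeries ℤ} {r : PowerSeries ℤ} {x y : K}
    (hs : ∀ j, s (j + 1) = PowerSeries.X * s j + r) (h0 : HasValue q (s 0) x) (hr : HasValue q r y)
    (j : ℕ) : HasValue q (s j) (q ^ j * x + (1 - q ^ j) / (1 - q) * y) := by
  induction j with
  | zero => simpa using h0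
  | succ j ih =>
    rw [hs]
    convert ih.X_mul.add hr using 1
    field_simp
    ring

/-- The multiplicity `m` on the columns in `U` and `0` elsewhere. -/
def multiplicity (U : Finset (Fin n)) (m : ℕ) (i : Fin n) : ℕ := if i ∈ U then m else 0

theorem multiplicity_insert {U : Finset (Fin n)} {v : Fin n} (hv : v ∉ U) (m : ℕ) :
    multiplicity (insert v U) m = multiplicity U m + Pi.single v m := by
  ext i
  rcases eq_or_ne i v with rfl | hi
  · simp [multiplicity, hv]
  · simp [multiplicity, hi]

/-- Adding one more copy of the column `v`, as a recursion in the number of copies. -/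
theorem zonotopeSeries_single_succ (hA : IsUnimodularMatrix A) {ε : ℤ} (hε : ε = 0 ∨ ε = 1)
    (μ : Fin n → ℕ) {T : Set (Fin n)} {v : Fin n} (hloop : ¬IsLoop A T v) (j : ℕ)
    (hwidth : ∀ h ∈ unitFunctionals A T, h (A.col v) ≠ 0 →
      2 * ε ≤ ∑ i, ((μ + Pi.single v j : Fin n → ℕ) i : ℤ) * |h (A.col i)| + 1) :
    zonotopeSeries A (μ + Pi.single v (j + 1)) ε T =
      PowerSeries.X * zonotopeSeries A (μ + Pi.single v j) ε T +
        zonotopeSeries A μ ε (insert v T) := by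
  rw [Pi.single_add, ← add_assoc, zonotopeSeries_add_single hA hε _ hloop hwidth]
  congr 1
  refine zonotopeSeries_congr ε fun i hi => ?_
  have : i ≠ v := by
    rintro rfl
    exact hi fun h hh => hh.2.2 i (Set.mem_insert i T)
  simp [this]

theorem HasValue.recursion_single (hq1 : 1 - q ≠ 0) (f : (Fin n → ℕ) → PowerSeries ℤ)
    (μ : Fin n → ℕ) (v : Fin n) {r : PowerSeries ℤ} {x y : K}
    (hs : ∀ j, f (μ + Pi.single v (j + 1)) = PowerSeries.X * f (μ + Pi.single v j) + r)
    (h0 : HasValue q (f (μ + Pi.single v 0)) x) (hr : HasValue q r y) (m : ℕ) :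
    HasValue q (f (μ + Pi.single v m)) (q ^ m * x + (1 - q ^ m) / (1 - q) * y) :=
  HasValue.recursion hq1 (s := fun j => f (μ + Pi.single v j)) hs h0 hr m

/-- The value of the count after adding `m` copies of the column `v`. -/
theorem HasValue.add_single (hA : IsUnimodularMatrix A) (hq1 : 1 - q ≠ 0) {ε : ℤ}
    (hε : ε = 0 ∨ ε = 1) {μ : Fin n → ℕ} {T : Set (Fin n)} {v : Fin n} (hloop : ¬IsLoop A T v)
    (hwidth : ∀ h ∈ unitFunctionals A T, h (A.col v) ≠ 0 →
      2 * ε ≤ ∑ i, μ i * |h (A.col i)| + 1) {x y : K}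
    (h0 : HasValue q (zonotopeSeries A μ ε T) x)
    (hr : HasValue q (zonotopeSeries A μ ε (insert v T)) y) (m : ℕ) :
    HasValue q (zonotopeSeries A (μ + Pi.single v m) ε T)
      (q ^ m * x + (1 - q ^ m) / (1 - q) * y) := by
  have hs : ∀ j, zonotopeSeries A (μ + Pi.single v (j + 1)) ε T =
      PowerSeries.X * zonotopeSeries A (μ + Pi.single v j) ε T +
        zonotopeSeries A μ ε (insert v T) := fun j => by
    refine zonotopeSeries_single_succ hA hε μ hloop j fun h hh hv => (hwidth h hh hv).trans ?_
    gcongr with i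
    simp
  have h0' : HasValue q (zonotopeSeries A (μ + Pi.single v 0) ε T) x := by
    rwa [Pi.single_zero, add_zero]
  exact HasValue.recursion_single hq1 (fun μ => zonotopeSeries A μ ε T) μ v hs h0' hr m

theorem unitFunctionals_union_insert (U : Finset (Fin n)) (T : Set (Fin n)) (v : Fin n) :
    unitFunctionals A (↑(insert v U) ∪ T) = unitFunctionals A (↑U ∪ insert v T) := by
  rw [Finset.coe_insert, Set.insert_union, Set.union_insert]

/-- The graded count of the `m`-th dilate, with the columns in `U` remaining and those in `T`
contracted, is `P (q ^ m)`. If these columns span, the count of the interior is given by the same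
polynomial with an endomorphism `θ` of the field applied to the coefficients, up to a monomial; in
the application `θ` inverts `q`. -/
structure IsCountingPolynomial (A : Matrix (Fin d) (Fin n) ℤ) (U : Finset (Fin n))
    (T : Set (Fin n)) (θ : K →+* K) (q : K) (P : Polynomial K) : Prop where
  natDegree_le : P.natDegree ≤ U.card
  closed : ∀ m, HasValue q (zonotopeSeries A (multiplicity U m) 0 T) (P.eval (q ^ m))
  interior : unitFunctionals A (↑U ∪ T) = ∅ → ∀ m, 1 ≤ m →
    HasValue q (zonotopeSeries A (multiplicity U m) 1 T)
      ((-q⁻¹) ^ corank A T * (P.map θ).eval (q ^ m))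

theorem unitFunctionals_union_eq_empty {U : Finset (Fin n)} {T : Set (Fin n)} {v : Fin n}
    (hT : unitFunctionals A (↑(insert v U) ∪ T) = ∅)
    (hv : ∀ h ∈ unitFunctionals A (↑U ∪ T), h (A.col v) = 0) :
    unitFunctionals A (↑U ∪ T) = ∅ := by
  refine Set.eq_empty_of_forall_notMem fun h hh => ?_
  have : h ∈ unitFunctionals A (↑(insert v U) ∪ T) := by
    refine ⟨hh.1, hh.2.1, ?_⟩
    rintro i (hi | hi)
    · rcases Finset.mem_insert.1 hi with rfl | hi
      · exact hv h hh
      · exact hh.2.2 i (Or.inl hi)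
    · exact hh.2.2 i (Or.inr hi)
  rw [hT] at this
  exact this

theorem unitFunctionals_anti {T T' : Set (Fin n)} (hT : T ⊆ T') :
    unitFunctionals A T' ⊆ unitFunctionals A T := fun _ hh =>
  ⟨hh.1, hh.2.1, fun i hi => hh.2.2 i (hT hi)⟩

/-- A column in the span of the contracted ones changes nothing, as only functions invariant under
it are considered. -/
theorem IsCountingPolynomial.insert_of_loop {U : Finset (Fin n)} {T : Set (Fin n)} {v : Fin n}
    (hvU : v ∉ U) (hloop : IsLoop A T v) {P : Polynomial K}
    (hP : IsCountingPolynomial A U T θ q P) : IsCountingPolynomial A (insert v U) T θ q P := by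
  have hcongr : ∀ ε m, zonotopeSeries A (multiplicity (insert v U) m) ε T =
      zonotopeSeries A (multiplicity U m) ε T := fun ε m =>
    zonotopeSeries_congr ε fun i hi => by
      have : i ≠ v := by
        rintro rfl
        exact hi hloop
      simp [multiplicity, this]
  refine ⟨hP.natDegree_le.trans (Finset.card_le_card (Finset.subset_insert v U)),
    fun m => by rw [hcongr]; exact hP.closed m, fun hT m hm => ?_⟩
  rw [hcongr]
  exact hP.interior (unitFunctionals_union_eq_empty hT fun h hh =>
    hloop h (unitFunctionals_anti Set.subset_union_right hh)) m hm

/-- The identity behind the passage to the interior for a column independent of the others: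
inverting `r` in the coefficients of the closed count with `m + 1` copies of the column gives those
of the interior count, whose recursion starts with one copy and the value `0`. -/
theorem coloop_reciprocity {r : K} (h0 : r ≠ 0) (h1 : 1 - r ≠ 0) (e m : ℕ)
    (y : K) : (-r⁻¹) ^ (e + 1) * ((r ^ (m + 1) + (1 - r⁻¹)⁻¹ * (1 - r ^ (m + 1))) * y) =
      r ^ m * 0 + (1 - r ^ m) / (1 - r) * ((-r⁻¹) ^ e * y) := by
  have h2 : r - 1 ≠ 0 := fun h => h1 (by linear_combination -h)
  have h3 : (1 - r⁻¹)⁻¹ = r / (r - 1) := by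
    rw [show 1 - r⁻¹ = (r - 1) / r by field_simp, inv_div]
  have h4 : -r⁻¹ * (r ^ (m + 1) + r / (r - 1) * (1 - r ^ (m + 1))) = (1 - r ^ m) / (1 - r) := by
    rw [show 1 - r = -(r - 1) by ring]
    field_simp
    ring
  rw [h3, pow_succ (-r⁻¹), ← h4]
  ring

/-- The form of the solution `z x + (1 - z) / (1 - r) y` of the deletion-contraction recursion is
preserved under the inversion of `r` in its coefficients, up to monomials whose exponents are the
coranks. -/
theorem deletion_contraction_reciprocity {r : K} (h0 : r ≠ 0)
    (h1 : 1 - r ≠ 0) (e : ℕ) (x y z : K) :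
    (-r⁻¹) ^ (e + 1) * (z * x + (1 - r⁻¹)⁻¹ * (1 - z) * y) =
      z * ((-r⁻¹) ^ (e + 1) * x) + (1 - z) / (1 - r) * ((-r⁻¹) ^ e * y) := by
  have h2 : r - 1 ≠ 0 := fun h => h1 (by linear_combination -h)
  have h3 : (1 - r⁻¹)⁻¹ = r / (r - 1) := by
    rw [show 1 - r⁻¹ = (r - 1) / r by field_simp, inv_div]
  have h4 : -r⁻¹ * (r / (r - 1) * (1 - z)) = (1 - z) / (1 - r) := by
    rw [show 1 - r = -(r - 1) by ring]
    field_simp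
  rw [h3, ← h4, pow_succ (-r⁻¹)]
  ring

/-- If the column `v` is independent of those in `U ∪ T`, deleting it completely amounts to
contracting it for the closed count, and leaves nothing of the interior. -/
theorem IsCountingPolynomial.insert_of_coloop (hA : IsUnimodularMatrix A)
    (hq0 : q ≠ 0) (hq1 : 1 - q ≠ 0) (hθ : θ q = q⁻¹) {U : Finset (Fin n)}
    {T : Set (Fin n)} {v : Fin n} (hvU : v ∉ U) {h : (Fin d → ℤ) →+ ℤ}
    (hh : h ∈ unitFunctionals A (↑U ∪ T)) (hv : h (A.col v) ≠ 0) {P : Polynomial K}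
    (hP : IsCountingPolynomial A U (insert v T) θ q P) :
    IsCountingPolynomial A (insert v U) T θ q
      ((Polynomial.X + Polynomial.C (1 - q)⁻¹ * (1 - Polynomial.X)) * P) := by
  have hhT : h ∈ unitFunctionals A T := unitFunctionals_anti Set.subset_union_right hh
  have hloop : ¬IsLoop A T v := fun hl => hv (hl h hhT)
  have hsum : ∀ m, ∑ i, (multiplicity U m i : ℤ) * |h (A.col i)| = 0 := fun m =>
    Finset.sum_eq_zero fun i _ => by
      by_cases hi : i ∈ U
      · simp [hh.2.2 i (Or.inl hi)]
      · simp [multiplicity, hi]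
  refine ⟨?_, fun m => ?_, fun hT m hm => ?_⟩
  · refine Polynomial.natDegree_mul_le.trans ?_
    have : (Polynomial.X + Polynomial.C (1 - q)⁻¹ * (1 - Polynomial.X)).natDegree ≤ 1 := by
      compute_degree
    have := hP.natDegree_le
    rw [Finset.card_insert_of_notMem hvU]
    omega
  · have h1 : HasValue q (zonotopeSeries A (multiplicity U m) 0 T) (P.eval (q ^ m)) := by
      rw [zonotopeSeries_insert_of_coloop hA _ ⟨h, hhT, hv, hsum m⟩]
      exact hP.closed m
    have h2 := h1.add_single hA hq1 (Or.inl rfl) hloop (fun g _ _ => by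
      rw [mul_zero]
      positivity) (hP.closed m) m
    rw [multiplicity_insert hvU]
    convert h2 using 1
    simp only [Polynomial.eval_mul, Polynomial.eval_add, Polynomial.eval_X, Polynomial.eval_C,
      Polynomial.eval_sub, Polynomial.eval_one]
    ring
  · obtain ⟨m, rfl⟩ : ∃ m', m = m' + 1 := ⟨m - 1, by omega⟩
    -- with a single copy of `v`, the functional `h` has width one
    have h1 : HasValue q (zonotopeSeries A (multiplicity U (m + 1) + Pi.single v 1) 1 T) 0 := by
      rw [zonotopeSeries_eq_zero _ ⟨h, hhT, ?_⟩]
      · exact hasValue_zero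
      · rw [sum_add_single_mul _ v fun i => |h (A.col i)|, hsum]
        rcases hh.2.1 v with h1 | h1 | h1 <;> simp [h1]
    rw [unitFunctionals_union_insert] at hT
    have hr : zonotopeSeries A (multiplicity U (m + 1) + Pi.single v 1) 1 (insert v T) =
        zonotopeSeries A (multiplicity U (m + 1)) 1 (insert v T) :=
      zonotopeSeries_congr 1 fun i hi => by
        have : i ≠ v := by
          rintro rfl
          exact hi fun h hh => hh.2.2 i (Set.mem_insert i T)
        simp [this]
    have h2 := h1.add_single hA hq1 (Or.inr rfl) hloop (fun g _ hg0 => by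
      rw [sum_add_single_mul _ v fun i => |g (A.col i)|]
      have h3 := Int.one_le_abs hg0
      have h4 : 0 ≤ ∑ i, (multiplicity U (m + 1) i : ℤ) * |g (A.col i)| := by positivity
      omega) (hr ▸ hP.interior hT (m + 1) hm) m
    rw [add_assoc, ← Pi.single_add, add_comm 1 m] at h2
    rw [multiplicity_insert hvU, corank_insert hloop]
    rw [← coloop_reciprocity hq0 hq1] at h2
    simpa only [Polynomial.map_mul, Polynomial.map_add, Polynomial.map_sub, Polynomial.map_X,
      Polynomial.map_C, Polynomial.map_one, Polynomial.eval_mul, Polynomial.eval_add,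
      Polynomial.eval_X, Polynomial.eval_C, Polynomial.eval_sub, Polynomial.eval_one,
      map_inv₀, map_sub, map_one, hθ] using h2

/-- If the column `v` lies in the span of those in `U ∪ T` but not in that of `T`, the recursion
starts with the deletion of all its copies, both for the closed count and for the interior. -/
theorem IsCountingPolynomial.insert_of_spanned (hA : IsUnimodularMatrix A)
    (hq0 : q ≠ 0) (hq1 : 1 - q ≠ 0) (hθ : θ q = q⁻¹) {U : Finset (Fin n)}
    {T : Set (Fin n)} {v : Fin n} (hvU : v ∉ U) (hloop : ¬IsLoop A T v)
    (hspan : ∀ h ∈ unitFunctionals A (↑U ∪ T), h (A.col v) = 0) {P P' : Polynomial K}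
    (hP : IsCountingPolynomial A U T θ q P) (hP' : IsCountingPolynomial A U (insert v T) θ q P') :
    IsCountingPolynomial A (insert v U) T θ q
      (Polynomial.X * P + Polynomial.C (1 - q)⁻¹ * (1 - Polynomial.X) * P') := by
  refine ⟨?_, fun m => ?_, fun hT m hm => ?_⟩
  · have h1 := hP.natDegree_le
    have h2 := hP'.natDegree_le
    rw [Finset.card_insert_of_notMem hvU]
    refine Polynomial.natDegree_add_le_of_degree_le (Polynomial.natDegree_mul_le.trans ?_)
      (Polynomial.natDegree_mul_le.trans ?_)
    · rw [Polynomial.natDegree_X]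
      omega
    · have : (Polynomial.C (1 - q)⁻¹ * (1 - Polynomial.X)).natDegree ≤ 1 := by
        compute_degree
      omega
  · have h2 := (hP.closed m).add_single hA hq1 (Or.inl rfl) hloop (fun g _ _ => by
      rw [mul_zero]
      positivity) (hP'.closed m) m
    rw [multiplicity_insert hvU]
    convert h2 using 1
    simp only [Polynomial.eval_mul, Polynomial.eval_add, Polynomial.eval_X, Polynomial.eval_C,
      Polynomial.eval_sub, Polynomial.eval_one]
    ring
  · have hT₁ := unitFunctionals_union_eq_empty hT hspan
    rw [unitFunctionals_union_insert] at hT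
    have hwidth : ∀ h ∈ unitFunctionals A T,
        1 ≤ ∑ i, (multiplicity U m i : ℤ) * |h (A.col i)| := fun h hh => by
      obtain ⟨u, hu, hu0⟩ : ∃ u ∈ U, h (A.col u) ≠ 0 := by
        by_contra! hall
        have : h ∈ unitFunctionals A (↑U ∪ T) := ⟨hh.1, hh.2.1, by
          rintro i (hi | hi)
          · exact hall i hi
          · exact hh.2.2 i hi⟩
        rw [hT₁] at this
        exact this
      refine le_trans ?_ (Finset.single_le_sum (fun i _ => by positivity) (Finset.mem_univ u))
      have h3 := Int.one_le_abs hu0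
      have h4 : (1 : ℤ) ≤ multiplicity U m u := by
        rw [multiplicity, if_pos hu]
        exact_mod_cast hm
      nlinarith
    have h2 := (hP.interior hT₁ m hm).add_single hA hq1 (Or.inr rfl) hloop
      (fun g hg _ => by
        have := hwidth g hg
        omega) (hP'.interior hT m hm) m
    rw [multiplicity_insert hvU]
    rw [corank_insert hloop] at h2 ⊢
    rw [← deletion_contraction_reciprocity hq0 hq1] at h2
    simpa only [Polynomial.map_mul, Polynomial.map_add, Polynomial.map_sub, Polynomial.map_X,
      Polynomial.map_C, Polynomial.map_one, Polynomial.eval_mul, Polynomial.eval_add,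
      Polynomial.eval_X, Polynomial.eval_C, Polynomial.eval_sub, Polynomial.eval_one,
      map_inv₀, map_sub, map_one, hθ] using h2

/-- Counting polynomials exist: they are built by adding the columns one at a time. -/
theorem exists_isCountingPolynomial (hA : IsUnimodularMatrix A) (hq0 : q ≠ 0)
    (hq1 : 1 - q ≠ 0) (hθ : θ q = q⁻¹) (U : Finset (Fin n))
    (T : Set (Fin n)) : ∃ P, IsCountingPolynomial A U T θ q P := by
  induction U using Finset.induction_on generalizing T with
  | empty =>
    refine ⟨1, by simp, fun m => ?_, fun hT m _ => ?_⟩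
    · have : multiplicity (∅ : Finset (Fin n)) m = 0 := by
        ext i
        simp [multiplicity]
      rw [this, zonotopeSeries_zero hA, Polynomial.eval_one]
      exact hasValue_one
    · rw [Finset.coe_empty, Set.empty_union] at hT
      rw [zonotopeSeries_eq_one_of_spanning hA hT, corank_eq_zero hA hT]
      simpa using hasValue_one
  | insert v U hvU ih =>
    obtain ⟨P, hP⟩ := ih T
    obtain ⟨P', hP'⟩ := ih (insert v T)
    by_cases hloop : IsLoop A T v
    · exact ⟨_, hP.insert_of_loop hvU hloop⟩
    by_cases hcoloop : ∃ h ∈ unitFunctionals A (↑U ∪ T), h (A.col v) ≠ 0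
    · obtain ⟨h, hh, hv⟩ := hcoloop
      exact ⟨_, hP'.insert_of_coloop hA hq0 hq1 hθ hvU hh hv⟩
    · push Not at hcoloop
      exact ⟨_, hP.insert_of_spanned hA hq0 hq1 hθ hvU hloop hcoloop hP'⟩

end Recursion

/-! ### Generating functions -/

section GeneratingFunction

/-- The bivariate power series with the `t`-coefficients `coeff k A`, which are polynomials
in `q`. -/
noncomputable def toBivariate (A : PowerSeries (Polynomial ℤ)) : MvPowerSeries (Fin 2) ℤ :=
  fun e => (PowerSeries.coeff (e 0) A).coeff (e 1)

/-- A polynomial in `t` over `ℤ[q]` as a polynomial in the two variables. -/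
noncomputable def polyToBivariate : Polynomial (Polynomial ℤ) →+* MvPolynomial (Fin 2) ℤ :=
  Polynomial.eval₂RingHom (Polynomial.aeval (MvPolynomial.X 1)).toRingHom (MvPolynomial.X 0)

theorem coeff_toBivariate (A : PowerSeries (Polynomial ℤ)) (e : Fin 2 →₀ ℕ) :
    MvPowerSeries.coeff e (toBivariate A) = (PowerSeries.coeff (e 0) A).coeff (e 1) := rfl

theorem polyToBivariate_C_X : polyToBivariate (Polynomial.C Polynomial.X) = MvPolynomial.X 1 := by
  simp [polyToBivariate]

theorem polyToBivariate_X : polyToBivariate Polynomial.X = MvPolynomial.X 0 := by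
  simp [polyToBivariate]

theorem polyToBivariate_monomial (k l : ℕ) (c : ℤ) :
    polyToBivariate (Polynomial.monomial k (Polynomial.monomial l c)) =
      MvPolynomial.monomial (Finsupp.single 0 k + Finsupp.single 1 l) c := by
  simp only [polyToBivariate, Polynomial.coe_eval₂RingHom, Polynomial.eval₂_monomial,
    AlgHom.toRingHom_eq_coe, RingHom.coe_coe, Polynomial.aeval_monomial]
  rw [MvPolynomial.monomial_eq, Finsupp.prod_add_index' (by simp) (by simp [pow_add])]
  simp
  ring

theorem toBivariate_mul (D : Polynomial (Polynomial ℤ)) (A : PowerSeries (Polynomial ℤ)) :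
    toBivariate ((D : PowerSeries (Polynomial ℤ)) * A) =
      (polyToBivariate D : MvPowerSeries (Fin 2) ℤ) * toBivariate A := by
  induction D using Polynomial.induction_on' with
  | add p r hp hr =>
    rw [map_add, MvPolynomial.coe_add, add_mul, ← hp, ← hr, Polynomial.coe_add, add_mul]
    ext e
    simp [coeff_toBivariate]
  | monomial k p =>
    induction p using Polynomial.induction_on' with
    | add p r hp hr =>
      rw [map_add, map_add, MvPolynomial.coe_add, add_mul, ← hp, ← hr, Polynomial.coe_add, add_mul]
      ext e
      simp [coeff_toBivariate]
    | monomial l c =>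
      rw [polyToBivariate_monomial]
      ext e
      rw [MvPolynomial.coe_monomial, MvPowerSeries.coeff_monomial_mul, coeff_toBivariate,
        coeff_toBivariate, ← Polynomial.C_mul_X_pow_eq_monomial,
        ← Polynomial.C_mul_X_pow_eq_monomial, Polynomial.coe_mul, Polynomial.coe_C,
        Polynomial.coe_pow, Polynomial.coe_X, mul_assoc, PowerSeries.coeff_C_mul,
        PowerSeries.coeff_X_pow_mul', mul_assoc, Polynomial.coeff_C_mul]
      have hle : (Finsupp.single 0 k + Finsupp.single 1 l ≤ e) ↔ k ≤ e 0 ∧ l ≤ e 1 := by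
        rw [Finsupp.le_def, Fin.forall_fin_two]
        simp
      rw [mul_comm (Polynomial.X ^ l), Polynomial.coeff_mul_X_pow']
      by_cases h0 : k ≤ e 0 <;> by_cases h1 : l ≤ e 1 <;> simp [hle, h0, h1]

theorem coe_polyToBivariate (g : Polynomial (Polynomial ℤ)) :
    (polyToBivariate g : MvPowerSeries (Fin 2) ℤ) = toBivariate g := by
  have h := toBivariate_mul g 1
  have h1 : toBivariate 1 = 1 := by
    ext e
    rw [coeff_toBivariate, PowerSeries.coeff_one, MvPowerSeries.coeff_one]
    by_cases h0 : e 0 = 0 <;> by_cases h1 : e 1 = 0 <;>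
      simp [h0, h1, Polynomial.coeff_one, Finsupp.ext_iff, Fin.forall_fin_two]
  rw [h1, mul_one, mul_one] at h
  exact h.symm

theorem degreeOf_polyToBivariate_le (g : Polynomial (Polynomial ℤ)) :
    (polyToBivariate g).degreeOf 0 ≤ g.natDegree := by
  rw [MvPolynomial.degreeOf_le_iff]
  intro e he
  have h1 := congrArg (MvPowerSeries.coeff e) (coe_polyToBivariate g)
  rw [MvPolynomial.coeff_coe, coeff_toBivariate, Polynomial.coeff_coe] at h1
  refine Polynomial.le_natDegree_of_ne_zero fun h0 => MvPolynomial.mem_support_iff.1 he ?_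
  rw [h1, h0, Polynomial.coeff_zero]

variable {K : Type*} [Field K]

theorem one_sub_mul_mk_pow (r : K) :
    (1 - PowerSeries.C r * PowerSeries.X) * PowerSeries.mk (fun m => r ^ m) = 1 := by
  ext m
  rw [sub_mul, one_mul, map_sub, mul_assoc, PowerSeries.coeff_C_mul, PowerSeries.coeff_one]
  cases m with
  | zero => simp
  | succ m =>
    rw [PowerSeries.coeff_succ_X_mul, PowerSeries.coeff_mk, PowerSeries.coeff_mk, pow_succ']
    simp

/-- If the values of `a m` at `q` are given by `P (q ^ m)`, the generating function of `a` becomes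
a polynomial of degree at most `n` when multiplied by `∏ (1 - qⁱ X)`, by partial fractions. -/
theorem exists_numerator {q : K}
    (hq : Function.Injective (Polynomial.eval₂RingHom (Int.castRingHom K) q))
    {a : ℕ → Polynomial ℤ} {P : Polynomial K} {n : ℕ} (hP : P.natDegree ≤ n)
    (ha : ∀ m, Polynomial.eval₂RingHom (Int.castRingHom K) q (a m) = P.eval (q ^ m)) :
    ∃ g : Polynomial (Polynomial ℤ), g.natDegree ≤ n ∧
      ((∏ i ∈ Finset.range (n + 1), (1 - Polynomial.C (Polynomial.X ^ i) * Polynomial.X) :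
        Polynomial (Polynomial ℤ)) : PowerSeries (Polynomial ℤ)) * PowerSeries.mk a = g ∧
      g.map (Polynomial.eval₂RingHom (Int.castRingHom K) q) =
        ∑ j ∈ Finset.range (n + 1), Polynomial.C (P.coeff j) *
          ∏ i ∈ (Finset.range (n + 1)).erase j, (1 - Polynomial.C (q ^ i) * Polynomial.X) := by
  set ι : Polynomial ℤ →+* K := (Polynomial.eval₂RingHom (Int.castRingHom K) q) with hι
  have hιX : ι Polynomial.X = q := by simp [hι]
  set D : Polynomial (Polynomial ℤ) :=
    ∏ i ∈ Finset.range (n + 1), (1 - Polynomial.C (Polynomial.X ^ i) * Polynomial.X) with hD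
  set M : Polynomial K := ∑ j ∈ Finset.range (n + 1), Polynomial.C (P.coeff j) *
    ∏ i ∈ (Finset.range (n + 1)).erase j, (1 - Polynomial.C (q ^ i) * Polynomial.X) with hM
  set G : PowerSeries (Polynomial ℤ) := (D : PowerSeries (Polynomial ℤ)) * PowerSeries.mk a with hG
  have hgeom : PowerSeries.mk (fun m => P.eval (q ^ m)) = ∑ j ∈ Finset.range (n + 1),
      PowerSeries.C (P.coeff j) * PowerSeries.mk (fun m => (q ^ j) ^ m) := by
    ext m
    rw [PowerSeries.coeff_mk, map_sum, Polynomial.eval_eq_sum_range' (Nat.lt_succ_of_le hP)]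
    refine Finset.sum_congr rfl fun j _ => ?_
    rw [PowerSeries.coeff_C_mul, PowerSeries.coeff_mk, pow_right_comm]
  have hmap : PowerSeries.map ι G = (M : PowerSeries K) := by
    have h1 : PowerSeries.map ι (D : PowerSeries (Polynomial ℤ)) =
        ∏ i ∈ Finset.range (n + 1), (1 - PowerSeries.C (q ^ i) * PowerSeries.X) := by
      rw [← Polynomial.polynomial_map_coe, hD, Polynomial.map_prod,
        ← Polynomial.coeToPowerSeries.ringHom_apply, map_prod]
      refine Finset.prod_congr rfl fun i _ => ?_
      simp [hιX]
    have h2 : PowerSeries.map ι (PowerSeries.mk a) =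
        PowerSeries.mk (fun m => P.eval (q ^ m)) := by
      ext m
      rw [PowerSeries.coeff_map, PowerSeries.coeff_mk, PowerSeries.coeff_mk, ← ha]
    rw [hG, map_mul, h1, h2, hgeom, Finset.mul_sum, hM,
      ← Polynomial.coeToPowerSeries.ringHom_apply, map_sum]
    refine Finset.sum_congr rfl fun j hj => ?_
    rw [map_mul, map_prod, ← Finset.mul_prod_erase _ _ hj]
    have h3 := one_sub_mul_mk_pow (q ^ j)
    simp only [Polynomial.coeToPowerSeries.ringHom_apply, Polynomial.coe_sub, Polynomial.coe_one,
      Polynomial.coe_mul, Polynomial.coe_C, Polynomial.coe_X]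
    linear_combination (PowerSeries.C (P.coeff j) *
      ∏ i ∈ (Finset.range (n + 1)).erase j, (1 - PowerSeries.C (q ^ i) * PowerSeries.X)) * h3
  have hMdeg : M.natDegree ≤ n := by
    refine Polynomial.natDegree_sum_le_of_forall_le _ _ fun j hj => ?_
    refine (Polynomial.natDegree_C_mul_le _ _).trans ((Polynomial.natDegree_prod_le _ _).trans ?_)
    refine (Finset.sum_le_card_nsmul _ _ 1 fun i _ => ?_).trans ?_
    · compute_degree
    · rw [Finset.card_erase_of_mem hj, Finset.card_range]
      simp
  have hcoeff : ∀ k, ι (PowerSeries.coeff k G) = M.coeff k := fun k => by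
    rw [← PowerSeries.coeff_map, hmap, Polynomial.coeff_coe]
  have hG0 : ∀ k, n < k → PowerSeries.coeff k G = 0 := fun k hk => by
    refine hq ?_
    have h1 := hcoeff k
    rw [Polynomial.coeff_eq_zero_of_natDegree_lt (hMdeg.trans_lt hk)] at h1
    exact h1.trans (map_zero _).symm
  have htrunc : G = (PowerSeries.trunc (n + 1) G : Polynomial (Polynomial ℤ)) := by
    ext1 k
    rw [Polynomial.coeff_coe, PowerSeries.coeff_trunc]
    split_ifs with hk
    · rfl
    · exact hG0 k (by omega)
  refine ⟨PowerSeries.trunc (n + 1) G, ?_, htrunc, ?_⟩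
  · exact Nat.lt_succ_iff.1 (PowerSeries.natDegree_trunc_lt G n)
  · ext k
    rw [Polynomial.coeff_map, ← hcoeff, PowerSeries.coeff_trunc]
    split_ifs with hk
    · rfl
    · rw [hG0 k (by omega)]

theorem sum_mul_prod_erase {t q : K} (n : ℕ) (hne : ∀ i, 1 - t * q ^ i ≠ 0) (c : ℕ → K) :
    (∑ j ∈ Finset.range (n + 1), Polynomial.C (c j) * ∏ i ∈ (Finset.range (n + 1)).erase j,
      (1 - Polynomial.C (q ^ i) * Polynomial.X)).eval t / ∏ i ∈ Finset.range (n + 1),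
        (1 - t * q ^ i) = ∑ j ∈ Finset.range (n + 1), c j / (1 - t * q ^ j) := by
  rw [Polynomial.eval_finsetSum, Finset.sum_div]
  refine Finset.sum_congr rfl fun j hj => ?_
  rw [Polynomial.eval_mul, Polynomial.eval_C, Polynomial.eval_prod, ← Finset.mul_prod_erase _ _ hj]
  have h1 : ∏ i ∈ (Finset.range (n + 1)).erase j,
      (1 - Polynomial.C (q ^ i) * Polynomial.X).eval t =
      ∏ i ∈ (Finset.range (n + 1)).erase j, (1 - t * q ^ i) :=
    Finset.prod_congr rfl fun i _ => by simp [mul_comm]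
  rw [h1]
  exact mul_div_mul_right _ _ (Finset.prod_ne_zero_iff.2 fun i _ => hne i)

theorem reciprocity_term {t q : K} (ht : t ≠ 0) (hq : q ≠ 0) (j : ℕ) (hne : 1 - t * q ^ j ≠ 0)
    (c : K) : t * (c * q ^ j / (1 - t * q ^ j)) = -(c / (1 - t⁻¹ * q⁻¹ ^ j)) := by
  have h1 : t * q ^ j - 1 ≠ 0 := fun h => hne (by linear_combination -h)
  have h2 : 1 - t⁻¹ * q⁻¹ ^ j = (t * q ^ j - 1) / (t * q ^ j) := by
    rw [inv_pow]
    field_simp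
  rw [h2, show 1 - t * q ^ j = -(t * q ^ j - 1) by ring]
  field_simp

theorem eval_polyToBivariate (t q : K) (g : Polynomial (Polynomial ℤ)) :
    MvPolynomial.eval₂Hom (Int.castRingHom K) ![t, q] (polyToBivariate g) =
      (g.map (Polynomial.eval₂RingHom (Int.castRingHom K) q)).eval t := by
  rw [Polynomial.eval_map]
  induction g using Polynomial.induction_on' with
  | add p r hp hr => rw [map_add, map_add, Polynomial.eval₂_add, ← hp, ← hr]
  | monomial k p =>
    induction p using Polynomial.induction_on' with
    | add p r hp hr =>
      rw [map_add, map_add, map_add, Polynomial.eval₂_add, ← hp, ← hr]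
    | monomial l c =>
      rw [polyToBivariate_monomial, MvPolynomial.coe_eval₂Hom, MvPolynomial.eval₂_monomial,
        Polynomial.eval₂_monomial, Finsupp.prod_add_index' (by simp) (by simp [pow_add])]
      simp
      ring

/-- The common denominator `∏ (1 - t qⁱ)` of the two series. -/
noncomputable def denominator (n : ℕ) : MvPolynomial (Fin 2) ℤ :=
  ∏ i ∈ Finset.range (n + 1), (1 - MvPolynomial.X 0 * MvPolynomial.X 1 ^ i)

theorem polyToBivariate_denominator (n : ℕ) : polyToBivariate
    (∏ i ∈ Finset.range (n + 1), (1 - Polynomial.C (Polynomial.X ^ i) * Polynomial.X)) =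
      denominator n := by
  rw [map_prod, denominator]
  refine Finset.prod_congr rfl fun i _ => ?_
  rw [map_sub, map_one, map_mul, map_pow, map_pow, polyToBivariate_C_X, polyToBivariate_X, mul_comm]

theorem denominator_ne_zero (n : ℕ) : denominator n ≠ 0 := fun h => by
  have := congrArg (MvPolynomial.eval 0) h
  simp [denominator] at this

theorem eval_denominator (t q : K) (n : ℕ) :
    MvPolynomial.eval₂Hom (Int.castRingHom K) ![t, q] (denominator n) =
      ∏ i ∈ Finset.range (n + 1), (1 - t * q ^ i) := by
  rw [denominator, map_prod]
  refine Finset.prod_congr rfl fun i _ => ?_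
  simp

/-- The expansion of a generating function whose coefficients are interpolated by `P`. -/
theorem exists_expansion {t q : K}
    (hq : Function.Injective (Polynomial.eval₂RingHom (Int.castRingHom K) q))
    (hne : ∀ i, 1 - t * q ^ i ≠ 0) {a : ℕ → Polynomial ℤ} {P : Polynomial K} {n : ℕ}
    (hP : P.natDegree ≤ n)
    (ha : ∀ m, Polynomial.eval₂RingHom (Int.castRingHom K) q (a m) = P.eval (q ^ m)) :
    ∃ N : MvPolynomial (Fin 2) ℤ, N.degreeOf 0 ≤ n ∧
      (denominator n : MvPowerSeries (Fin 2) ℤ) * toBivariate (PowerSeries.mk a) = N ∧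
      MvPolynomial.eval₂Hom (Int.castRingHom K) ![t, q] N /
          ∏ i ∈ Finset.range (n + 1), (1 - t * q ^ i) =
        ∑ j ∈ Finset.range (n + 1), P.coeff j / (1 - t * q ^ j) := by
  obtain ⟨g, hg, hDg, hmap⟩ := exists_numerator hq hP ha
  refine ⟨polyToBivariate g, (degreeOf_polyToBivariate_le g).trans hg, ?_, ?_⟩
  · rw [← polyToBivariate_denominator, ← toBivariate_mul, hDg, coe_polyToBivariate]
  · rw [eval_polyToBivariate, hmap]
    exact sum_mul_prod_erase n hne _

end GeneratingFunction

section RationalFunctions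

open RatTQ

theorem algebraMap_ne_zero {p : MvPolynomial (Fin 2) ℚ} (hp : p ≠ 0) :
    algebraMap (MvPolynomial (Fin 2) ℚ) RatTQ p ≠ 0 := fun h =>
  hp (IsFractionRing.injective (MvPolynomial (Fin 2) ℚ) RatTQ (h.trans (map_zero _).symm))

theorem eval_q_injective :
    Function.Injective (Polynomial.eval₂RingHom (Int.castRingHom RatTQ) q) := by
  have h1 : ∀ p : Polynomial ℤ, Polynomial.eval₂RingHom (Int.castRingHom RatTQ) q p =
      algebraMap (MvPolynomial (Fin 2) ℚ) RatTQ (Polynomial.eval₂RingHom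
        (Int.castRingHom (MvPolynomial (Fin 2) ℚ)) (MvPolynomial.X 1) p) := fun p => by
    rw [Polynomial.coe_eval₂RingHom, Polynomial.coe_eval₂RingHom, Polynomial.hom_eval₂, q]
    congr 1
    exact RingHom.ext_int _ _
  have h2 : ∀ p : Polynomial ℤ, MvPolynomial.aeval (fun _ : Fin 2 => (Polynomial.X : Polynomial ℚ))
      (Polynomial.eval₂RingHom (Int.castRingHom (MvPolynomial (Fin 2) ℚ)) (MvPolynomial.X 1) p) =
      p.map (Int.castRingHom ℚ) := fun p => by
    induction p using Polynomial.induction_on' with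
    | add p r hp hr => rw [map_add, map_add, hp, hr, Polynomial.map_add]
    | monomial k c =>
      simp [← Polynomial.C_mul_X_pow_eq_monomial, -eq_intCast, -map_intCast]
      rw [map_intCast, map_intCast]
  intro p p' hpp
  rw [h1, h1] at hpp
  have h3 := IsFractionRing.injective (MvPolynomial (Fin 2) ℚ) RatTQ hpp
  have h4 := h2 p
  rw [h3, h2] at h4
  exact (Polynomial.map_injective _ Int.cast_injective h4).symm

theorem one_sub_q_ne_zero : (1 : RatTQ) - q ≠ 0 := by
  have h : (1 - MvPolynomial.X 1 : MvPolynomial (Fin 2) ℚ) ≠ 0 := fun h => by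
    have := congrArg (MvPolynomial.eval 0) h
    simp at this
  have h1 := algebraMap_ne_zero h
  rw [map_sub, map_one] at h1
  exact h1

theorem one_sub_t_mul_q_pow_ne_zero (i : ℕ) : 1 - t * q ^ i ≠ 0 := by
  have h : (1 - MvPolynomial.X 0 * MvPolynomial.X 1 ^ i : MvPolynomial (Fin 2) ℚ) ≠ 0 := fun h => by
    have := congrArg (MvPolynomial.eval 0) h
    simp at this
  have h1 := algebraMap_ne_zero h
  rw [map_sub, map_one, map_mul, map_pow] at h1
  exact h1

theorem ofPoly_eq_eval (N : MvPolynomial (Fin 2) ℤ) :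
    ofPoly N = MvPolynomial.eval₂Hom (Int.castRingHom RatTQ) ![t, q] N := by
  rw [ofPoly, MvPolynomial.aeval_def, MvPolynomial.coe_eval₂Hom]
  congr 1
  exact RingHom.ext_int _ _

end RationalFunctions

/-! ### Reciprocity -/

section Reciprocity

variable {d n : ℕ} {A : Matrix (Fin d) (Fin n) ℤ} {K : Type*} [Field K]

theorem ehrhartSeries_zonotope (hA : IsUnimodularMatrix A) {a : ℕ → Polynomial ℤ}
    (ha : ∀ m, (a m : PowerSeries ℤ) = zonotopeSeries A (fun _ => m) 0 ∅) :
    ehrhartSeries (zonotope A) = toBivariate (PowerSeries.mk a) := by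
  funext e
  rw [ehrhartSeries, gradedCount_zonotope hA, ← ha, toBivariate, PowerSeries.coeff_mk,
    Polynomial.coeff_coe]

theorem interiorEhrhartSeries_zonotope (hA : IsUnimodularMatrix A) {a : ℕ → Polynomial ℤ}
    (ha : ∀ m, (a m : PowerSeries ℤ) = zonotopeSeries A (fun _ => m + 1) 1 ∅) :
    interiorEhrhartSeries (zonotope A) =
      (MvPolynomial.X 0 : MvPolynomial (Fin 2) ℤ) * toBivariate (PowerSeries.mk a) := by
  ext e
  rw [MvPolynomial.X, MvPolynomial.coe_monomial, MvPowerSeries.coeff_monomial_mul, one_mul,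
    coeff_toBivariate, PowerSeries.coeff_mk]
  change (if e 0 = 0 then 0 else PowerSeries.coeff (e 1) (gradedInteriorCount _ (e 0))) = _
  have hle : Finsupp.single 0 1 ≤ e ↔ e 0 ≠ 0 := by
    rw [Finsupp.le_def, Fin.forall_fin_two]
    simp [Nat.one_le_iff_ne_zero]
  by_cases h0 : e 0 = 0
  · rw [if_pos h0, if_neg (by rwa [hle, not_not])]
  · rw [if_neg h0, if_pos (hle.2 h0), gradedInteriorCount_zonotope hA]
    have h1 : (e - Finsupp.single 0 1 : Fin 2 →₀ ℕ) 0 + 1 = e 0 := by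
      simp only [Finsupp.coe_tsub, Pi.sub_apply, Finsupp.single_eq_same]
      omega
    rw [← Polynomial.coeff_coe, ha, h1]
    simp

/-- Both series have the denominator `∏ (1 - t qⁱ)`, and their values are reciprocal. -/
theorem exists_numerators (hA : IsUnimodularMatrix A) {t q : K} {θ : K →+* K} (ht : t ≠ 0)
    (hq : q ≠ 0) (hθt : θ t = t⁻¹) (hθq : θ q = q⁻¹) (hq1 : 1 - q ≠ 0)
    (hinj : Function.Injective (Polynomial.eval₂RingHom (Int.castRingHom K) q))
    (hne : ∀ i, 1 - t * q ^ i ≠ 0) :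
    ∃ N N' : MvPolynomial (Fin 2) ℤ, N.degreeOf 0 ≤ n ∧ N'.degreeOf 0 ≤ n ∧
      (denominator n : MvPowerSeries (Fin 2) ℤ) * ehrhartSeries (zonotope A) = N ∧
      (denominator n : MvPowerSeries (Fin 2) ℤ) * interiorEhrhartSeries (zonotope A) =
        (MvPolynomial.X 0 * N' : MvPolynomial (Fin 2) ℤ) ∧
      q ^ d * (t * MvPolynomial.eval₂Hom (Int.castRingHom K) ![t, q] N' /
          ∏ i ∈ Finset.range (n + 1), (1 - t * q ^ i)) =
        (-1) ^ (d + 1) * θ (MvPolynomial.eval₂Hom (Int.castRingHom K) ![t, q] N /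
          ∏ i ∈ Finset.range (n + 1), (1 - t * q ^ i)) := by
  obtain ⟨P, hP⟩ := exists_isCountingPolynomial hA hq hq1 hθq Finset.univ ∅
  have hmult : ∀ m, multiplicity (Finset.univ : Finset (Fin n)) m = fun _ => m := fun m => by
    ext i
    simp [multiplicity]
  have hdeg : P.natDegree ≤ n := hP.natDegree_le.trans_eq (by simp)
  have hspan : unitFunctionals A (↑(Finset.univ : Finset (Fin n)) ∪ ∅) = ∅ := by
    refine Set.eq_empty_of_forall_notMem fun h hh => ?_
    obtain ⟨v, hv⟩ := exists_col_ne_zero hA hh.1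
    exact hv (hh.2.2 v (by simp))
  choose a ha haP using hP.closed
  choose b hb hbP using fun m => hP.interior hspan (m + 1) m.succ_pos
  simp only [hmult] at ha hb
  -- The interior polynomial with its argument rescaled, as the series starts at `m = 1`.
  set P' : Polynomial K := (Polynomial.C ((-q⁻¹) ^ d) * P.map θ).comp
    (Polynomial.C q * Polynomial.X) with hP'
  have hdeg' : P'.natDegree ≤ n := by
    refine Polynomial.natDegree_comp_le.trans ?_
    rw [Polynomial.natDegree_C_mul_X _ hq, mul_one]
    exact (Polynomial.natDegree_C_mul_le _ _).trans (Polynomial.natDegree_map_le.trans hdeg)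
  have hcoeff : ∀ j, P'.coeff j = (-q⁻¹) ^ d * θ (P.coeff j) * q ^ j := fun j => by
    rw [hP', Polynomial.comp_C_mul_X_coeff, Polynomial.coeff_C_mul, Polynomial.coeff_map]
  obtain ⟨N, hN, hDN, hNP⟩ := exists_expansion hinj hne hdeg haP
  obtain ⟨N', hN', hDN', hNP'⟩ := exists_expansion hinj hne hdeg' (a := b) fun m => by
    rw [hbP, hP', corank_empty, Polynomial.eval_comp, Polynomial.eval_mul, Polynomial.eval_C,
      Polynomial.eval_mul, Polynomial.eval_C, Polynomial.eval_X, pow_succ']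
  refine ⟨N, N', hN, hN', ?_, ?_, ?_⟩
  · rw [ehrhartSeries_zonotope hA ha, hDN]
  · rw [interiorEhrhartSeries_zonotope hA hb, mul_left_comm, hDN', MvPolynomial.coe_mul]
  · rw [mul_div_assoc, hNP, hNP', map_sum, Finset.mul_sum, Finset.mul_sum, Finset.mul_sum]
    refine Finset.sum_congr rfl fun j _ => ?_
    have hqd : q ^ d * (-q⁻¹) ^ d = (-1) ^ d := by
      rw [← mul_pow, mul_neg, mul_inv_cancel₀ hq]
    rw [hcoeff, map_div₀, map_sub, map_one, map_mul, map_pow, hθt, hθq]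
    have h1 := reciprocity_term ht hq j (hne j) (θ (P.coeff j))
    rw [pow_succ, mul_assoc ((-1 : K) ^ d), neg_one_mul, ← h1, ← hqd]
    ring

end Reciprocity

end GradedEhrhart

theorem mainTheorem2 {d n : ℕ} (A : Matrix (Fin d) (Fin n) ℤ) (hA : IsUnimodularMatrix A) :
    ∃ E E' : RatTQ,
      RatTQ.IsExpansion (ehrhartSeries (zonotope A)) E ∧
      RatTQ.IsExpansion (interiorEhrhartSeries (zonotope A)) E' ∧
      (∃ N : MvPolynomial (Fin 2) ℤ, N.degreeOf 0 ≤ n ∧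
        E = RatTQ.ofPoly N / ∏ i ∈ Finset.range (n + 1), (1 - RatTQ.t * RatTQ.q ^ i)) ∧
      (∃ N' : MvPolynomial (Fin 2) ℤ, N'.degreeOf 0 ≤ n ∧
        E' = RatTQ.t * RatTQ.ofPoly N' /
          ∏ i ∈ Finset.range (n + 1), (1 - RatTQ.t * RatTQ.q ^ i)) ∧
      RatTQ.q ^ d * E' = (-1) ^ (d + 1) * RatTQ.invVars E := by
  obtain ⟨N, N', hN, hN', hDN, hDN', hrec⟩ := GradedEhrhart.exists_numerators hA RatTQ.t_ne_zero
    RatTQ.q_ne_zero (θ := (RatTQ.invVars : RatTQ →+* RatTQ)) RatTQ.invVars_t RatTQ.invVars_q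
    GradedEhrhart.one_sub_q_ne_zero GradedEhrhart.eval_q_injective
    GradedEhrhart.one_sub_t_mul_q_pow_ne_zero
  refine ⟨_, _, ⟨N, GradedEhrhart.denominator n, GradedEhrhart.denominator_ne_zero n, hDN, ?_⟩,
    ⟨MvPolynomial.X 0 * N', GradedEhrhart.denominator n, GradedEhrhart.denominator_ne_zero n, hDN',
      ?_⟩, ⟨N, hN, ?_⟩, ⟨N', hN', ?_⟩, hrec⟩
  · rw [GradedEhrhart.ofPoly_eq_eval, GradedEhrhart.ofPoly_eq_eval, GradedEhrhart.eval_denominator]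
  · rw [GradedEhrhart.ofPoly_eq_eval, GradedEhrhart.ofPoly_eq_eval, GradedEhrhart.eval_denominator,
      map_mul, MvPolynomial.coe_eval₂Hom, MvPolynomial.eval₂_X, Matrix.cons_val_zero]
  · rw [GradedEhrhart.ofPoly_eq_eval]
  · rw [GradedEhrhart.ofPoly_eq_eval]
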